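/- Let $n\ge 3$, let $T$ be the set of transpositions of the symmetric group $\mathfrak S_n$ and let $c=(1\ 2\ \cdots\ n)$; permutations are composed from right to left. For $w\in\mathfrak S_n$ let $\ell_T(w)$ be the least number of transpositions whose product is $w$, and let $\le_T$ be the absolute order: $u\le_T w$ if and only if $\ell_T(w)=\ell_T(u)+\ell_T(u^{-1}w)$. Let $NC(\mathfrak S_n,c)=\{v\in\mathfrak S_n : e\le_T v\le_T c\}$, which is a lattice under $\le_T$ and contains $T$. Let the noncrossing projection $\pi_T(w)$ be the join, in $NC(\mathfrak S_n,c)$, of all $t\in T$ with $t\le_T w$, and put $\mathrm{Pop}_T(w)=w\cdot\pi_T(w)^{-1}$. The forward orbit of $w$ is $O_{\mathrm{Pop}_T}(w)=\{w,\mathrm{Pop}_T(w),\mathrm{Pop}_T^2(w),\dots\}$. An antiexceedance of $w$ is an $i\in\{1,\dots,n\}$ with $i<w^{-1}(i)$, and $w$ is called $A$-splittable if it has exactly $n-2$ antiexceedances and $\pi_T(w)$ has exactly one non-singleton cycle. Then a permutation $w\in\mathfrak S_n$ satisfies $|O_{\mathrm{Pop}_T}(w)|=n-1$ if and only if $w$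 is $A$-splittable. In particular, the number of $w\in\mathfrak S_n$ with $|O_{\mathrm{Pop}_T}(w)|=n-1$ is $2^n-\binom n2-1$. -/

import Mathlib

/-- The word length `ℓ_T(w)`: the least length of an expression of `w` as a product of
elements of `T`. -/
noncomputable def reflLength {G : Type*} [Group G] (T : Set G) (w : G) : ℕ :=
  sInf {k : ℕ | ∃ l : List G, (∀ t ∈ l, t ∈ T) ∧ l.prod = w ∧ l.length = k}

/-- The absolute order: `u ≤_T w` iff `ℓ_T(w) = ℓ_T(u) + ℓ_T(u⁻¹ w)`. -/
def AbsLE {G : Type*} [Group G] (T : Set G) (u w : G) : Prop :=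
  reflLength T w = reflLength T u + reflLength T (u⁻¹ * w)

/-- The noncrossing partitions relative to `c`: the interval `[e, c]` of the absolute order. -/
def NC {G : Type*} [Group G] (T : Set G) (c : G) : Set G :=
  {v | AbsLE T 1 v ∧ AbsLE T v c}

/-- `v` is the join, in the poset `NC T c`, of a set `X` of group elements. -/
def IsNCJoin {G : Type*} [Group G] (T : Set G) (c : G) (X : Set G) (v : G) : Prop :=
  v ∈ NC T c ∧ (∀ t ∈ X, AbsLE T t v) ∧
    ∀ u ∈ NC T c, (∀ t ∈ X, AbsLE T t u) → AbsLE T v u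

open Classical in
/-- The noncrossing projection `π_T(w)`: the join in `NC T c` of all `t ∈ T` with `t ≤_T w`.
For a finite Coxeter group with reflections `T` and Coxeter element `c` the poset `NC T c` is a
lattice containing `T`, so the join exists; the value `1` is used for other data only. -/
noncomputable def ncProj {G : Type*} [Group G] (T : Set G) (c w : G) : G :=
  if h : ∃ v, IsNCJoin T c {t | t ∈ T ∧ AbsLE T t w} v then h.choose else 1

/-- Coxeter pop-tsack torsing: `Pop_T(w) = w · π_T(w)⁻¹`. -/
noncomputable def popT {G : Type*} [Group G] (T : Set G) (c w : G) : G :=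
  w * (ncProj T c w)⁻¹

/-- The forward orbit `{x, f x, f (f x), …}`. -/
def forwardOrbit {X : Type*} (f : X → X) (x : X) : Set X :=
  Set.range fun k : ℕ => f^[k] x

/-- The reflections of the symmetric group: all transpositions. -/
def transpositions (n : ℕ) : Set (Equiv.Perm (Fin n)) :=
  {t | t.IsSwap}

/-- The noncrossing projection on the symmetric group for the Coxeter element
`c = (1 2 ⋯ n)`, which is `finRotate n` on the ground set `Fin n = {0, …, n - 1}`. -/
noncomputable def ncProjA {n : ℕ} (w : Equiv.Perm (Fin n)) : Equiv.Perm (Fin n) :=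
  ncProj (transpositions n) (finRotate n) w

/-- Pop-tsack torsing on the symmetric group for the Coxeter element `c = (1 2 ⋯ n)`. -/
noncomputable def popTA {n : ℕ} (w : Equiv.Perm (Fin n)) : Equiv.Perm (Fin n) :=
  popT (transpositions n) (finRotate n) w

/-- The number of antiexceedances: indices `i` with `i < w⁻¹(i)`. -/
def aexc {n : ℕ} (w : Equiv.Perm (Fin n)) : ℕ :=
  (Finset.univ.filter fun i : Fin n => i < w⁻¹ i).card

/-- The number of non-singleton cycles. -/
def cyc {n : ℕ} (w : Equiv.Perm (Fin n)) : ℕ :=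
  w.cycleFactorsFinset.card

/-- `w` has exactly `n - 2` antiexceedances and `π_T(w)` has exactly one non-singleton cycle. -/
def ASplittable {n : ℕ} (w : Equiv.Perm (Fin n)) : Prop :=
  (aexc w : ℤ) = (n : ℤ) - 2 ∧ cyc (ncProjA w) = 1

/-! Permutations are lifted to the line: `x` moves forward by `cdist x (w⁻¹ x)`, a fixed point
making a full turn. Summing these distances shows that the total winding number is `n - aexc w`.

In the symmetric group `NC` consists of noncrossing partitions, each block cycled forward, and
`π_T(w)` is the noncrossing closure of the cycle partition of `w`. Since `(Pop w)⁻¹ = π_T(w) w⁻¹`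
and `π_T(w)` never carries `w⁻¹ x` past `x`, winding numbers add (`aexc_popTA_add_desc`): each step
lowers `aexc` by `desc (π_T(w))`, the number of nontrivial blocks. Hence an orbit has at most `aexc
w + 1` elements, and exactly that many if one block occurs at every step.

Writing `w⁻¹ = c s`, one gets `aexc w = n - 1 - desc s` (`aexc_add_desc`). The value `n - 1` occurs
only for `w = c⁻¹`, whose orbit has `n` elements. So an orbit of size `n - 1` forces `aexc w = n -
2` and a single block at the first step: `w` is A-splittable.

Conversely, `aexc w = n - 2` makes `s` the increasing cycle on a set `S` of at least two points. If
`S` is a pair that is not cyclically adjacent, two complementary arcs are stable and `π_T(w)` has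
two blocks. In all other cases `w⁻¹` satisfies `Good`, a condition on inversions of the lift that
forces a single block (`Good.desc_ncProjA`) and survives Pop (`Good.pop`). Counting the admissible
`S`, that is, all sets of size at least 3 and the `n` adjacent pairs, gives the formula. -/

namespace PopTsack
open Equiv Equiv.Perm

variable {n : ℕ}

/-! ### Cyclic distance -/

/-- The cyclic distance from `x` forward to `y`, with values in `{1, …, n}`; in particular the
distance from a point to itself is `n`. -/
def cdist (x y : Fin n) : ℕ := if x.val < y.val then y.val - x.val else n + y.val - x.val

lemma cdist_spec (x y : Fin n) :
    (x.val < y.val ∧ cdist x y + x.val = y.val) ∨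
      (y.val ≤ x.val ∧ cdist x y + x.val = n + y.val) := by
  have := x.isLt
  unfold cdist
  split_ifs <;> omega

lemma cdist_pos (x y : Fin n) : 0 < cdist x y := by
  have := cdist_spec x y
  have := x.isLt
  omega

lemma cdist_le (x y : Fin n) : cdist x y ≤ n := by
  have := cdist_spec x y
  have := y.isLt
  omega

@[simp] lemma cdist_self (x : Fin n) : cdist x x = n := by
  have := cdist_spec x x
  omega

lemma cdist_lt_of_ne {x y : Fin n} (h : x ≠ y) : cdist x y < n := by
  have := cdist_spec x y
  have : x.val ≠ y.val := fun h' => h (Fin.ext h')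
  have := y.isLt
  omega

lemma cdist_inj {x y z : Fin n} (h : cdist x y = cdist x z) : y = z := by
  have := cdist_spec x y
  have := cdist_spec x z
  have := y.isLt
  have := z.isLt
  exact Fin.ext (by omega)

/-- Either `y` comes no later than `z` when going around from `x`, or it comes after. -/
lemma cdist_add (x y z : Fin n) :
    (cdist x y < cdist x z ∧ cdist x y + cdist y z = cdist x z) ∨
      (cdist x z ≤ cdist x y ∧ cdist x y + cdist y z = cdist x z + n) := by
  have := cdist_spec x y
  have := cdist_spec x z
  have := cdist_spec y z
  have := x.isLt
  have := y.isLt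
  have := z.isLt
  omega

/-! ### Noncrossing permutations through stable arcs -/

/-- Every forward arc from a point `x` to its image `u x` is stable under `p`. -/
def ArcsStable (u p : Perm (Fin n)) : Prop :=
  ∀ x y, cdist x y < cdist x (u x) → cdist x (p y) < cdist x (u x)

/-- The cycles of `u` are increasing in the cyclic order, and they do not cross. -/
def IsNC (u : Perm (Fin n)) : Prop := ArcsStable u u

lemma rel_of_sameCycle {u : Perm (Fin n)} (r : Setoid (Fin n)) (h : ∀ y, r y (u y))
    {y z : Fin n} (hyz : u.SameCycle y z) : r y z := by
  obtain ⟨k, rfl⟩ := hyz.exists_nat_pow_eq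
  clear hyz
  induction k with
  | zero => exact r.refl y
  | succ k ih => rw [pow_succ']; exact r.trans ih (h _)

lemma mem_of_sameCycle {u : Perm (Fin n)} {A : Set (Fin n)} (h : ∀ y ∈ A, u y ∈ A)
    {y z : Fin n} (hyz : u.SameCycle y z) (hy : y ∈ A) : z ∈ A := by
  obtain ⟨k, rfl⟩ := hyz.exists_nat_pow_eq
  clear hyz
  induction k with
  | zero => exact hy
  | succ k ih => rw [pow_succ']; exact h _ ih

lemma sameCycle_apply (u : Perm (Fin n)) (x : Fin n) : u.SameCycle x (u x) := ⟨1, by simp⟩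

lemma ArcsStable.sameCycle {u p : Perm (Fin n)} (h : ArcsStable u p) {x y z : Fin n}
    (hyz : p.SameCycle y z) (hy : cdist x y < cdist x (u x)) : cdist x z < cdist x (u x) :=
  mem_of_sameCycle (A := {y | cdist x y < cdist x (u x)}) (fun y hy => h x y hy) hyz hy

/-- A cycle that meets the open arc from `x` to `u x` stays inside it, but `x` itself is outside
because `cdist x x = n`. -/
lemma IsNC.cdist_apply_le {u : Perm (Fin n)} (h : IsNC u) {x y : Fin n} (hxy : u.SameCycle x y) :
    cdist x (u x) ≤ cdist x y := by
  by_contra! hlt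
  have := ArcsStable.sameCycle h hxy.symm hlt
  have := cdist_le x (u x)
  rw [cdist_self] at *
  omega

/-- A point outside the cycle of `x` lies on an arc between consecutive points of the cycle. -/
lemma exists_arc {u : Perm (Fin n)} {x z : Fin n} (h : ¬ u.SameCycle x z) :
    ∃ a, u.SameCycle x a ∧ cdist a z < cdist a (u a) := by
  classical
  obtain ⟨a, ha, hmin⟩ := Finset.exists_min_image (Finset.univ.filter fun a => u.SameCycle x a)
    (fun a => cdist a z) ⟨x, by simp [SameCycle.refl]⟩
  simp only [Finset.mem_filter, Finset.mem_univ, true_and] at ha hmin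
  refine ⟨a, ha, ?_⟩
  by_contra! hle
  have h1 : u.SameCycle x (u a) := ha.trans (sameCycle_apply u a)
  have h2 := hmin _ h1
  have h3 : cdist a (u a) ≠ cdist a z := fun h' => h (cdist_inj h' ▸ h1)
  have := cdist_add a (u a) z
  have := cdist_pos a (u a)
  omega

/-- Only the arcs at `x` and `y` change, to end at `u y` and `u x`. By symmetry one suffices: the
arc from `x` to `u y` passes `y`, and a point leaving it would have to cross an arc of the cycle of
`x` and `y`. -/
lemma IsNC.mul_swap {u : Perm (Fin n)} (h : IsNC u) {x y : Fin n} (hne : x ≠ y)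
    (hxy : u.SameCycle x y) : IsNC (u * swap x y) := by
  have key : ∀ x y : Fin n, x ≠ y → u.SameCycle x y → ∀ a, cdist x a < cdist x (u y) →
      cdist x ((u * swap x y) a) < cdist x (u y) := by
    intro x y hne hxy a ha
    have hx := h.cdist_apply_le hxy
    have hy := h.cdist_apply_le hxy.symm
    have hxa : a ≠ x := by
      rintro rfl
      have := cdist_le a (u y)
      simp at ha
      omega
    have hadd := cdist_add x y (u y)
    have hadd' := cdist_add x y x
    have := cdist_pos y (u y)
    have := cdist_lt_of_ne hne
    rw [cdist_self] at hadd'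
    by_cases hay : a = y
    · subst hay
      rw [Perm.mul_apply, swap_apply_right]
      omega
    rw [Perm.mul_apply, swap_apply_of_ne_of_ne hxa hay]
    by_contra! hcon
    have hay' : cdist x a ≠ cdist x y := fun h' => hay (cdist_inj h')
    rcases lt_or_gt_of_ne hay' with hlt | hgt
    · have h1 := cdist_add x a y
      have h2 := cdist_add x a (u a)
      have h3 := cdist_add x a x
      have h4 : cdist a y < cdist a (u a) := by
        have := cdist_pos a (u a); have := cdist_pos a y; omega
      have h5 := ArcsStable.sameCycle h hxy.symm h4
      have := cdist_le x (u a)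
      have := cdist_pos a (u a)
      rw [cdist_self] at h3
      omega
    · have h1 := cdist_add x y a
      have h2 := cdist_add x y (u a)
      have h4 : cdist y a < cdist y (u y) := by have := cdist_pos y a; omega
      have h5 := h y a h4
      have := cdist_pos y (u a)
      have := cdist_le x (u a)
      omega
  intro z a ha
  by_cases hzx : z = x
  · subst hzx
    rw [Perm.mul_apply u _ z, swap_apply_left] at ha ⊢
    exact key z y hne hxy a ha
  by_cases hzy : z = y
  · subst hzy
    rw [Perm.mul_apply u _ z, swap_apply_right] at ha ⊢
    rw [swap_comm]
    exact key z x hne.symm hxy.symm a ha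
  rw [Perm.mul_apply u _ z, swap_apply_of_ne_of_ne hzx hzy] at ha ⊢
  rw [Perm.mul_apply]
  apply h
  by_cases hax : a = x
  · subst hax; rw [swap_apply_left]; exact ArcsStable.sameCycle h hxy ha
  by_cases hay : a = y
  · subst hay; rw [swap_apply_right]; exact ArcsStable.sameCycle h hxy.symm ha
  rwa [swap_apply_of_ne_of_ne hax hay]

/-- If all arcs of a noncrossing `u` are stable under `p`, then cycles of `p` refine those
of `u`. -/
lemma ArcsStable.sameCycle_apply {u p : Perm (Fin n)} (h : ArcsStable u p) (hu : IsNC u)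
    (x : Fin n) : u.SameCycle x (p x) := by
  by_contra hcon
  obtain ⟨a, ha, hlt⟩ := exists_arc hcon
  have h1 := h.sameCycle (PopTsack.sameCycle_apply p x).symm hlt
  have := hu.cdist_apply_le ha.symm
  omega

/-- The new arc at `x` is an arc of `p`. The new arc at `y` is the complement of what is left of
that arc once the old arcs at `x` and `y` are removed, and all three are stable under `p`. -/
lemma ArcsStable.mul_swap {u p : Perm (Fin n)} (h : ArcsStable u p) (hu : IsNC u) (hp : IsNC p)
    {x y : Fin n} (hne : x ≠ y) (hy : u y = p x) (hxy : u.SameCycle x y) :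
    ArcsStable (u * swap x y) p := by
  intro z a ha
  by_cases hzx : z = x
  · subst hzx
    rw [Perm.mul_apply u _ z, swap_apply_left, hy] at ha ⊢
    exact hp z a ha
  by_cases hzy : z = y
  · subst hzy
    rw [Perm.mul_apply u _ z, swap_apply_right] at ha ⊢
    have hx' := hu.cdist_apply_le hxy
    have hy' := hu.cdist_apply_le hxy.symm
    have e1 := h z a
    have e2 := h x a
    have e3 : cdist x (p a) < cdist x (u z) → cdist x a < cdist x (u z) := fun h' => by
      rw [hy] at h' ⊢
      exact ArcsStable.sameCycle hp (PopTsack.sameCycle_apply p a).symm h'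
    have l1 := cdist_add z x a
    have l2 := cdist_add z x (p a)
    have l3 := cdist_add z x (u x)
    have l4 := cdist_add z x (u z)
    have l5 := cdist_pos x a
    have l6 := cdist_pos x (p a)
    have l7 := cdist_pos x (u z)
    have l8 := cdist_add z x z
    have l9 := cdist_le z x
    have l10 := cdist_le z (p a)
    have l11 := cdist_le z a
    have l12 := cdist_pos x (u x)
    have l13 := cdist_pos z (u x)
    have l15 := cdist_pos z (u z)
    have l14 := cdist_lt_of_ne hne.symm
    rw [cdist_self] at l8
    omega
  rw [Perm.mul_apply u _ z, swap_apply_of_ne_of_ne hzx hzy] at ha ⊢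
  exact h z a ha

/-! ### Cycle counts and reflection length -/

lemma sameCycle_mul_swap_of_not {w : Perm (Fin n)} {x y : Fin n} (h : ¬ w.SameCycle x y) :
    (w * swap x y).SameCycle x y := by
  by_contra h'
  have hx : (w * swap x y) x = w y := by simp
  have hmem : w y ∈ {z | (w * swap x y).SameCycle x z ∧ w.SameCycle y z} :=
    ⟨hx ▸ sameCycle_apply _ x, sameCycle_apply w y⟩
  refine h' (mem_of_sameCycle (u := w) ?_ (sameCycle_apply w y).symm hmem).1
  rintro z ⟨h1, h2⟩
  refine ⟨?_, h2.trans (sameCycle_apply w z)⟩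
  have hzx : z ≠ x := by rintro rfl; exact h h2.symm
  have hzy : z ≠ y := by rintro rfl; exact h' h1
  have : (w * swap x y) z = w z := by rw [Perm.mul_apply, swap_apply_of_ne_of_ne hzx hzy]
  exact this ▸ h1.trans (sameCycle_apply _ z)

lemma not_sameCycle_mul_swap {w : Perm (Fin n)} {x y : Fin n} (hne : x ≠ y)
    (h : w.SameCycle x y) : ¬ (w * swap x y).SameCycle x y := by
  classical
  -- Follow `w` from `w y` up to the first visit to `x` or `y`. If `x` comes first, this segment is
  -- closed under `w * swap x y` and omits `y`; if `y` does, it is closed under `w` and omits `x`.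
  have hex : ∃ j, (w ^ (j + 1)) y = x ∨ (w ^ (j + 1)) y = y := by
    refine ⟨orderOf w - 1, Or.inr ?_⟩
    rw [Nat.sub_add_cancel (orderOf_pos w), pow_orderOf_eq_one, Perm.one_apply]
  obtain ⟨j, hj, hmin⟩ : ∃ j, ((w ^ (j + 1)) y = x ∨ (w ^ (j + 1)) y = y) ∧
      ∀ i < j, (w ^ (i + 1)) y ≠ x ∧ (w ^ (i + 1)) y ≠ y :=
    ⟨Nat.find hex, Nat.find_spec hex, fun i hi => not_or.mp (Nat.find_min hex hi)⟩
  have step : ∀ i, w ((w ^ (i + 1)) y) = (w ^ (i + 1 + 1)) y := fun i => by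
    rw [pow_succ' w (i + 1), Perm.mul_apply]
  rcases hj with hj | hj
  · intro hcon
    have := mem_of_sameCycle (A := {z | ∃ i ≤ j, (w ^ (i + 1)) y = z}) (z := y) ?_ hcon
      ⟨j, le_rfl, hj⟩
    · obtain ⟨i, hi, hiy⟩ := this
      rcases hi.lt_or_eq with hi | rfl
      · exact (hmin i hi).2 hiy
      · exact hne (hj.symm.trans hiy)
    · rintro z ⟨i, hi, rfl⟩
      rcases hi.lt_or_eq with hi | rfl
      · refine ⟨i + 1, hi, ?_⟩
        rw [Perm.mul_apply, swap_apply_of_ne_of_ne (hmin i hi).1 (hmin i hi).2, step]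
      · refine ⟨0, Nat.zero_le _, ?_⟩
        rw [hj]; simp
  · exfalso
    have := mem_of_sameCycle (A := {z | ∃ i ≤ j, (w ^ (i + 1)) y = z}) (z := x) ?_ h.symm
      ⟨j, le_rfl, hj⟩
    · obtain ⟨i, hi, hix⟩ := this
      rcases hi.lt_or_eq with hi | rfl
      · exact (hmin i hi).1 hix
      · exact hne (hix.symm.trans hj)
    · rintro z ⟨i, hi, rfl⟩
      rcases hi.lt_or_eq with hi | rfl
      · exact ⟨i + 1, hi, (step i).symm⟩
      · refine ⟨0, Nat.zero_le _, ?_⟩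
        rw [hj]; simp

/-- The number of cycles of `w`, fixed points included: each cycle is counted at its least
element. -/
noncomputable def numCycles (w : Perm (Fin n)) : ℕ :=
  open Classical in (Finset.univ.filter fun a => ∀ b, w.SameCycle a b → a ≤ b).card

lemma numCycles_le (w : Perm (Fin n)) : numCycles w ≤ n :=
  (Finset.card_filter_le _ _).trans (by simp)

lemma numCycles_one : numCycles (1 : Perm (Fin n)) = n := by
  classical
  unfold numCycles
  rw [Finset.filter_true_of_mem, Finset.card_univ, Fintype.card_fin]
  rintro a - b ⟨k, hk⟩
  simp at hk
  exact hk.le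

lemma sameCycle_of_sameCycle_mul_swap {w : Perm (Fin n)} {x y a b : Fin n}
    (h : w.SameCycle x y) (hab : (w * swap x y).SameCycle a b) : w.SameCycle a b := by
  refine rel_of_sameCycle (SameCycle.setoid w) (fun z => ?_) hab
  change w.SameCycle z (w (swap x y z))
  refine SameCycle.trans (y := swap x y z) ?_ (sameCycle_apply w _)
  by_cases hzx : z = x
  · subst hzx; simpa using h
  by_cases hzy : z = y
  · subst hzy; simpa using h.symm
  rw [swap_apply_of_ne_of_ne hzx hzy]

lemma sameCycle_mul_swap_cases {w : Perm (Fin n)} {x y a b : Fin n} (hab : w.SameCycle a b) :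
    (w * swap x y).SameCycle a b ∨
      ((w * swap x y).SameCycle a x ∧ (w * swap x y).SameCycle y b) ∨
      ((w * swap x y).SameCycle a y ∧ (w * swap x y).SameCycle x b) := by
  set v := w * swap x y with hv
  obtain ⟨k, rfl⟩ := hab.exists_nat_pow_eq
  clear hab
  induction k with
  | zero => exact Or.inl (SameCycle.refl _ _)
  | succ k ih =>
    rw [pow_succ', Perm.mul_apply]
    generalize (w ^ k) a = c at ih
    by_cases hcx : c = x
    · subst hcx
      have : w c = v y := by simp [hv]
      have hy : v.SameCycle y (w c) := this ▸ sameCycle_apply v y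
      rcases ih with h | h | h
      · exact Or.inr (Or.inl ⟨h, hy⟩)
      · exact Or.inr (Or.inl ⟨h.1, hy⟩)
      · exact Or.inl (h.1.trans hy)
    by_cases hcy : c = y
    · subst hcy
      have : w c = v x := by simp [hv]
      have hy : v.SameCycle x (w c) := this ▸ sameCycle_apply v x
      rcases ih with h | h | h
      · exact Or.inr (Or.inr ⟨h, hy⟩)
      · exact Or.inl (h.1.trans hy)
      · exact Or.inr (Or.inr ⟨h.1, hy⟩)
    have : w c = v c := by rw [hv, Perm.mul_apply, swap_apply_of_ne_of_ne hcx hcy]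
    have hc : v.SameCycle c (w c) := this ▸ sameCycle_apply v c
    rcases ih with h | h | h
    · exact Or.inl (h.trans hc)
    · exact Or.inr (Or.inl ⟨h.1, h.2.trans hc⟩)
    · exact Or.inr (Or.inr ⟨h.1, h.2.trans hc⟩)

lemma exists_least_sameCycle (w : Perm (Fin n)) (x : Fin n) :
    ∃ m, w.SameCycle x m ∧ ∀ b, w.SameCycle x b → m ≤ b := by
  classical
  obtain ⟨a, ha, hmin⟩ := Finset.exists_min_image (Finset.univ.filter fun a => w.SameCycle x a)
    id ⟨x, by simp [SameCycle.refl]⟩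
  simp only [Finset.mem_filter, Finset.mem_univ, true_and, id] at ha hmin
  exact ⟨a, ha, hmin⟩

lemma numCycles_mul_swap {w : Perm (Fin n)} {x y : Fin n} (hne : x ≠ y)
    (h : w.SameCycle x y) : numCycles (w * swap x y) = numCycles w + 1 := by
  classical
  have hnot := not_sameCycle_mul_swap hne h
  obtain ⟨m, hm, hmin⟩ := exists_least_sameCycle (w * swap x y) x
  obtain ⟨m', hm', hmin'⟩ := exists_least_sameCycle (w * swap x y) y
  have hle : ∀ {a b}, (w * swap x y).SameCycle a b → w.SameCycle a b :=
    sameCycle_of_sameCycle_mul_swap h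
  have hcases := fun a b => sameCycle_mul_swap_cases (w := w) (x := x) (y := y) (a := a) (b := b)
  have hmm : m ≠ m' := by rintro rfl; exact hnot (hm.trans hm'.symm)
  have hwmm : w.SameCycle m m' := (hle hm).symm.trans (h.trans (hle hm'))
  generalize w * swap x y = v at *
  unfold numCycles
  -- Of the least points of the two new cycles, the smaller was already the least point of the old
  -- cycle; the larger is the only new one.
  have hmax : max m m' ∈ Finset.univ.filter fun a => ∀ b, v.SameCycle a b → a ≤ b := by
    simp only [Finset.mem_filter, Finset.mem_univ, true_and]
    intro b hb
    rcases max_cases m m' with ⟨h1, -⟩ | ⟨h1, -⟩ <;> rw [h1] at hb ⊢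
    · exact hmin b (hm.trans hb)
    · exact hmin' b (hm'.trans hb)
  rw [← Finset.card_erase_add_one hmax, eq_comm]
  congr 2
  ext a
  simp only [Finset.mem_filter, Finset.mem_univ, true_and, Finset.mem_erase]
  constructor
  · intro ha
    refine ⟨?_, fun b hb => ha b (hle hb)⟩
    rintro rfl
    rcases lt_or_gt_of_ne hmm with hlt | hlt
    · rw [max_eq_right hlt.le] at ha
      exact absurd (ha m hwmm.symm) (not_le.mpr hlt)
    · rw [max_eq_left hlt.le] at ha
      exact absurd (ha m' hwmm) (not_le.mpr hlt)
  · rintro ⟨hane, ha⟩ b hb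
    rcases hcases a b hb with h1 | ⟨h1, h2⟩ | ⟨h1, h2⟩
    · exact ha b h1
    · have : a = m := le_antisymm (ha m (h1.trans hm)) (hmin a h1.symm)
      subst this
      have : ¬ m' ≤ a := fun h' => hane (max_eq_left h').symm
      exact (not_le.mp this).le.trans (hmin' b h2)
    · have : a = m' := le_antisymm (ha m' (h1.trans hm')) (hmin' a h1.symm)
      subst this
      have : ¬ m ≤ a := fun h' => hane (max_eq_right h').symm
      exact (not_le.mp this).le.trans (hmin b h2)

lemma numCycles_mul_swap_of_not {w : Perm (Fin n)} {x y : Fin n}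
    (h : ¬ w.SameCycle x y) : numCycles (w * swap x y) + 1 = numCycles w := by
  have hne : x ≠ y := by rintro rfl; exact h (SameCycle.refl _ _)
  have := numCycles_mul_swap hne (sameCycle_mul_swap_of_not h)
  rw [mul_assoc, swap_mul_self, mul_one] at this
  exact this.symm

lemma numCycles_mul_list (w : Perm (Fin n)) (l : List (Perm (Fin n)))
    (hl : ∀ t ∈ l, t ∈ transpositions n) : numCycles w ≤ numCycles (w * l.prod) + l.length ∧
      numCycles (w * l.prod) ≤ numCycles w + l.length := by
  induction l generalizing w with
  | nil => simp
  | cons t l ih =>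
    have h1 := ih (w * t) (fun s hs => hl s (List.mem_cons_of_mem _ hs))
    obtain ⟨x, y, hne, rfl⟩ := hl t List.mem_cons_self
    rw [List.prod_cons, ← mul_assoc, List.length_cons]
    by_cases h : w.SameCycle x y
    · have := numCycles_mul_swap hne h; omega
    · have := numCycles_mul_swap_of_not h; omega

lemma exists_list (w : Perm (Fin n)) : ∃ l : List (Perm (Fin n)),
    (∀ t ∈ l, t ∈ transpositions n) ∧ l.prod = w ∧ l.length + numCycles w = n := by
  induction hk : n - numCycles w generalizing w with
  | zero =>
    have hw : w = 1 := by
      by_contra hne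
      obtain ⟨x, hx⟩ : ∃ x, w x ≠ x := by
        by_contra! h
        exact hne (Equiv.ext h)
      have := numCycles_mul_swap hx.symm (sameCycle_apply w x)
      have := numCycles_le (w * swap x (w x))
      omega
    subst hw
    exact ⟨[], by simp, rfl, by simp [numCycles_one]⟩
  | succ k ih =>
    have hne : w ≠ 1 := by rintro rfl; rw [numCycles_one] at hk; omega
    obtain ⟨x, hx⟩ : ∃ x, w x ≠ x := by
      by_contra! h
      exact hne (Equiv.ext h)
    have h1 := numCycles_mul_swap hx.symm (sameCycle_apply w x)
    obtain ⟨l, hl, hp, hlen⟩ := ih (w * swap x (w x)) (by omega)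
    refine ⟨l ++ [swap x (w x)], ?_, ?_, ?_⟩
    · intro t ht
      rcases List.mem_append.mp ht with ht | ht
      · exact hl t ht
      · rw [List.mem_singleton.mp ht]
        exact ⟨_, _, hx.symm, rfl⟩
    · rw [List.prod_append, hp, List.prod_singleton, mul_assoc, swap_mul_self, mul_one]
    · rw [List.length_append, List.length_singleton]; omega

lemma reflLength_add_numCycles (w : Perm (Fin n)) :
    reflLength (transpositions n) w + numCycles w = n := by
  obtain ⟨l, hl, hp, hlen⟩ := exists_list w
  have h1 : reflLength (transpositions n) w ≤ l.length := Nat.sInf_le ⟨l, hl, hp, rfl⟩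
  obtain ⟨l', hl', hp', hlen'⟩ := Nat.sInf_mem
    (s := {k : ℕ | ∃ l : List (Perm (Fin n)), (∀ t ∈ l, t ∈ transpositions n) ∧
      l.prod = w ∧ l.length = k}) ⟨_, l, hl, hp, rfl⟩
  have h2 := (numCycles_mul_list 1 l' hl').1
  rw [one_mul, hp', numCycles_one, hlen'] at h2
  unfold reflLength at *
  omega

lemma exists_reduced (w : Perm (Fin n)) : ∃ l : List (Perm (Fin n)),
    (∀ t ∈ l, t ∈ transpositions n) ∧ l.prod = w ∧
      l.length = reflLength (transpositions n) w := by
  obtain ⟨l, hl, hp, hlen⟩ := exists_list w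
  have := reflLength_add_numCycles w
  exact ⟨l, hl, hp, by omega⟩

lemma reflLength_mul_le (u v : Perm (Fin n)) : reflLength (transpositions n) (u * v) ≤
    reflLength (transpositions n) u + reflLength (transpositions n) v := by
  obtain ⟨l, hl, hp, hlen⟩ := exists_reduced u
  obtain ⟨l', hl', hp', hlen'⟩ := exists_reduced v
  rw [← hlen, ← hlen', ← List.length_append]
  refine Nat.sInf_le ⟨l ++ l', ?_, by rw [List.prod_append, hp, hp'], rfl⟩
  intro t ht
  rcases List.mem_append.mp ht with ht | ht
  · exact hl t ht
  · exact hl' t ht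

lemma reflLength_one : reflLength (transpositions n) 1 = 0 := by
  have := reflLength_add_numCycles (1 : Perm (Fin n))
  rw [numCycles_one] at this
  omega

lemma eq_one_of_reflLength_eq_zero {w : Perm (Fin n)}
    (h : reflLength (transpositions n) w = 0) : w = 1 := by
  obtain ⟨l, -, hp, hlen⟩ := exists_reduced w
  rw [h, List.length_eq_zero_iff] at hlen
  rw [← hp, hlen, List.prod_nil]

lemma reflLength_mul_swap {w : Perm (Fin n)} {x y : Fin n} (hne : x ≠ y)
    (h : w.SameCycle x y) :
    reflLength (transpositions n) (w * swap x y) + 1 = reflLength (transpositions n) w := by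
  have := numCycles_mul_swap hne h
  have := reflLength_add_numCycles w
  have := reflLength_add_numCycles (w * swap x y)
  omega

lemma reflLength_mul_swap_of_not {w : Perm (Fin n)} {x y : Fin n} (h : ¬ w.SameCycle x y) :
    reflLength (transpositions n) (w * swap x y) = reflLength (transpositions n) w + 1 := by
  have := numCycles_mul_swap_of_not h
  have := reflLength_add_numCycles w
  have := reflLength_add_numCycles (w * swap x y)
  omega

lemma reflLength_swap {x y : Fin n} (hne : x ≠ y) :
    reflLength (transpositions n) (swap x y) = 1 := by
  have := reflLength_mul_swap_of_not (w := 1) (x := x) (y := y)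
    (by rintro ⟨k, hk⟩; simp at hk; exact hne hk)
  rwa [one_mul, reflLength_one] at this

lemma absLE_one (w : Perm (Fin n)) : AbsLE (transpositions n) 1 w := by
  simp [AbsLE, reflLength_one]

lemma absLE_swap_iff {w : Perm (Fin n)} {x y : Fin n} (hne : x ≠ y) :
    AbsLE (transpositions n) (swap x y) w ↔ w.SameCycle x y := by
  -- Conjugation turns the left factor into a right one, where the splitting lemmas apply.
  have hconj : (swap x y)⁻¹ * w = w * swap (w⁻¹ x) (w⁻¹ y) := by
    rw [swap_inv, mul_swap_eq_swap_mul]; simp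
  have hne' : w⁻¹ x ≠ w⁻¹ y := fun h => hne (w⁻¹.injective h)
  have hiff : w.SameCycle (w⁻¹ x) (w⁻¹ y) ↔ w.SameCycle x y :=
    sameCycle_symm_apply_left.trans sameCycle_symm_apply_right
  unfold AbsLE
  rw [reflLength_swap hne, hconj, ← hiff]
  constructor
  · intro h
    by_contra hcon
    have := reflLength_mul_swap_of_not hcon
    omega
  · intro h
    have := reflLength_mul_swap hne' h
    omega

lemma absLE_antisymm {u v : Perm (Fin n)} (h : AbsLE (transpositions n) u v)
    (h' : AbsLE (transpositions n) v u) : u = v := by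
  unfold AbsLE at h h'
  have := eq_one_of_reflLength_eq_zero (w := u⁻¹ * v) (by omega)
  exact (inv_mul_eq_one.mp this)

/-! ### The absolute order below a noncrossing permutation -/

lemma val_finRotate (x : Fin n) :
    (finRotate n x).val = if x.val + 1 < n then x.val + 1 else 0 := by
  obtain _ | m := n
  · exact x.elim0
  · by_cases h : x.val + 1 < m + 1
    · rw [if_pos h]
      exact congrArg Fin.val (finRotate_of_lt (by omega : x.val < m))
    · rw [if_neg h]
      have : x = Fin.last m := Fin.ext (by have := x.isLt; simp; omega)
      rw [this, finRotate_last]; rfl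

lemma cdist_finRotate (x : Fin n) : cdist x (finRotate n x) = 1 := by
  have h := val_finRotate x
  have := cdist_spec x (finRotate n x)
  have := x.isLt
  split_ifs at h <;> omega

lemma isNC_finRotate : IsNC (finRotate n) := by
  intro x y h
  rw [cdist_finRotate] at h
  have := cdist_pos x y
  omega

/-- Since each factor changes the length by one, the length condition forces every swap to split a
cycle. -/
lemma isNC_of_mul_list {z : Perm (Fin n)} (hz : IsNC z) (l : List (Perm (Fin n)))
    (hl : ∀ t ∈ l, t ∈ transpositions n) (hlen : reflLength (transpositions n) z =
      reflLength (transpositions n) (z * l.prod) + l.length) : IsNC (z * l.prod) := by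
  induction l generalizing z with
  | nil => simpa using hz
  | cons t l ih =>
    have hl' : ∀ s ∈ l, s ∈ transpositions n := fun s hs => hl s (List.mem_cons_of_mem _ hs)
    obtain ⟨x, y, hne, rfl⟩ := hl t List.mem_cons_self
    rw [List.prod_cons, ← mul_assoc] at hlen ⊢
    rw [List.length_cons] at hlen
    have h1 := numCycles_mul_list (z * swap x y) l hl'
    have h2 := reflLength_add_numCycles (z * swap x y)
    have h3 := reflLength_add_numCycles (z * swap x y * l.prod)
    by_cases h : z.SameCycle x y
    · have := reflLength_mul_swap hne h
      exact ih (hz.mul_swap hne h) hl' (by omega)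
    · have := reflLength_mul_swap_of_not h
      omega

lemma isNC_of_absLE {u z : Perm (Fin n)} (hz : IsNC z) (h : AbsLE (transpositions n) u z) :
    IsNC u := by
  obtain ⟨l, hl, hp, hlen⟩ := exists_reduced (u⁻¹ * z)
  have hrev : ∀ t ∈ l.reverse, t ∈ transpositions n := fun t ht => hl t (List.mem_reverse.mp ht)
  have hprod : l.reverse.prod = l.prod⁻¹ := by
    rw [List.prod_inv_reverse]
    have : l.map (fun t => t⁻¹) = l := by
      refine (List.map_congr_left (g := id) fun t ht => ?_).trans (List.map_id l)
      obtain ⟨x, y, -, rfl⟩ := hl t ht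
      exact swap_inv x y
    rw [this]
  have hu : z * l.reverse.prod = u := by rw [hprod, hp]; group
  rw [← hu]
  refine isNC_of_mul_list hz _ hrev ?_
  rw [hu, List.length_reverse, hlen]
  exact h

/-- Induction on the number of points where `p` and `u` differ: splitting a cycle of `u` by `swap x
(u⁻¹ (p x))` makes them agree at `x`, keeps the hypotheses, and lowers the length by one. -/
lemma absLE_of_arcsStable {p u : Perm (Fin n)} (hp : IsNC p) (hu : IsNC u)
    (h : ArcsStable u p) : AbsLE (transpositions n) p u := by
  induction hk : (Finset.univ.filter fun x => p x ≠ u x).card using Nat.strong_induction_on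
    generalizing u with
  | _ k ih =>
    by_cases hpu : p = u
    · subst hpu
      simp [AbsLE, reflLength_one]
    obtain ⟨x, hx⟩ : ∃ x, p x ≠ u x := by
      by_contra! hcon
      exact hpu (Equiv.ext hcon)
    set y := u⁻¹ (p x) with hy
    have huy : u y = p x := by simp [hy]
    have hxy : u.SameCycle x y :=
      (h.sameCycle_apply hu x).trans (huy ▸ (sameCycle_apply u y).symm)
    have hne : x ≠ y := by intro h'; rw [← h'] at huy; exact hx huy.symm
    have hle := ih _ ?_ (hu.mul_swap hne hxy) (h.mul_swap hu hp hne huy hxy) rfl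
    · have h1 := reflLength_mul_swap hne hxy
      have h2 := reflLength_mul_le p (p⁻¹ * u)
      have h3 := reflLength_mul_le (p⁻¹ * (u * swap x y)) (swap x y)
      rw [mul_inv_cancel_left] at h2
      rw [reflLength_swap hne, mul_assoc, mul_assoc, swap_mul_self, mul_one] at h3
      unfold AbsLE at hle ⊢
      omega
    · rw [← hk]
      apply Finset.card_lt_card
      refine ⟨fun z hz => ?_, fun hsub => ?_⟩
      · rw [Finset.mem_filter] at hz ⊢
        refine ⟨Finset.mem_univ _, ?_⟩
        replace hz := hz.2
        rw [Perm.mul_apply] at hz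
        intro hzu
        by_cases hzx : z = x
        · subst hzx; exact hx hzu
        by_cases hzy : z = y
        · rw [hzy] at hzu; exact hne (p.injective (hzu.trans huy).symm)
        rw [swap_apply_of_ne_of_ne hzx hzy] at hz
        exact hz hzu
      · have := hsub (Finset.mem_filter.mpr ⟨Finset.mem_univ x, hx⟩)
        refine (Finset.mem_filter.mp this).2 ?_
        rw [Perm.mul_apply, swap_apply_left, huy]

/-! ### The noncrossing projection as a noncrossing closure -/

/-- No two pairs of related points in different classes cross. -/
def NonCrossing (r : Setoid (Fin n)) : Prop :=
  ∀ x z a b, r x z → r a b → cdist x a < cdist x z → cdist x z ≤ cdist x b → r x a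

/-- Otherwise `a` lies on an arc between consecutive points of the cycle of `x`; the cycle of `a` is
trapped there and cannot reach `b`. -/
lemma IsNC.nonCrossing {u : Perm (Fin n)} (h : IsNC u) : NonCrossing (SameCycle.setoid u) := by
  intro x z a b hxz hab h1 h2
  by_contra hcon
  obtain ⟨e, he, hlt⟩ := exists_arc hcon
  have h3 := ArcsStable.sameCycle h hab hlt
  have hx := h.cdist_apply_le he.symm
  have hz := h.cdist_apply_le (he.symm.trans hxz)
  have := cdist_add x e a
  have := cdist_add x e b
  have := cdist_add x e z
  have := cdist_add x e x
  have := cdist_le x b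
  have := cdist_pos e a
  have := cdist_pos e b
  have := cdist_pos e z
  have := cdist_le e (u e)
  rw [cdist_self] at *
  omega

lemma exists_next (r : Setoid (Fin n)) (x : Fin n) :
    ∃ z, r x z ∧ ∀ y, r x y → cdist x z ≤ cdist x y := by
  classical
  obtain ⟨a, ha, hmin⟩ := Finset.exists_min_image (Finset.univ.filter fun a => r x a)
    (fun a => cdist x a) ⟨x, by simp⟩
  simp only [Finset.mem_filter, Finset.mem_univ, true_and] at ha hmin
  exact ⟨a, ha, hmin⟩

/-- The point following `x` in its class, in the cyclic order. -/
noncomputable def next (r : Setoid (Fin n)) (x : Fin n) : Fin n := (exists_next r x).choose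

lemma next_rel (r : Setoid (Fin n)) (x : Fin n) : r x (next r x) :=
  (exists_next r x).choose_spec.1

lemma cdist_next_le {r : Setoid (Fin n)} {x y : Fin n} (h : r x y) :
    cdist x (next r x) ≤ cdist x y :=
  (exists_next r x).choose_spec.2 y h

lemma next_injective (r : Setoid (Fin n)) : Function.Injective (next r) := by
  intro x y h
  by_contra hne
  have hxy : r x y := r.trans (next_rel r x) (h ▸ r.symm (next_rel r y))
  have h1 := cdist_next_le hxy
  have h2 := cdist_next_le (r.symm hxy)
  rw [← h] at h2
  have := cdist_add x y (next r x)
  have := cdist_add x y x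
  have := cdist_lt_of_ne hne
  have := cdist_pos x (next r x)
  have := cdist_pos y (next r x)
  rw [cdist_self] at *
  omega

/-- The permutation that cycles every class in the cyclic order. -/
noncomputable def nextPerm (r : Setoid (Fin n)) : Perm (Fin n) :=
  Equiv.ofBijective (next r) (Finite.injective_iff_bijective.mp (next_injective r))

lemma nextPerm_apply (r : Setoid (Fin n)) (x : Fin n) : nextPerm r x = next r x := rfl

lemma nextPerm_sameCycle_iff {r : Setoid (Fin n)} {x y : Fin n} :
    (nextPerm r).SameCycle x y ↔ r x y := by
  have himp : ∀ {x y}, (nextPerm r).SameCycle x y → r x y :=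
    fun h => rel_of_sameCycle r (next_rel r) h
  refine ⟨himp, fun h => ?_⟩
  by_contra hcon
  obtain ⟨a, ha, hlt⟩ := exists_arc hcon
  have := cdist_next_le (r.trans (r.symm (himp ha)) h)
  rw [nextPerm_apply] at hlt
  omega

lemma isNC_nextPerm {r : Setoid (Fin n)} (h : NonCrossing r) : IsNC (nextPerm r) := by
  intro x a ha
  by_contra! hcon
  have h1 := h x _ a _ (next_rel r x) (next_rel r a) ha hcon
  have := cdist_next_le h1
  rw [nextPerm_apply] at ha
  omega

/-- The noncrossing closure of the partition into cycles of `w`. -/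
def ncClosure (w : Perm (Fin n)) : Setoid (Fin n) :=
  sInf {r | NonCrossing r ∧ ∀ x, r x (w x)}

lemma ncClosure_iff {w : Perm (Fin n)} {x y : Fin n} :
    ncClosure w x y ↔ ∀ r : Setoid (Fin n), NonCrossing r → (∀ x, r x (w x)) → r x y :=
  ⟨fun h r h1 h2 => h r ⟨h1, h2⟩, fun h r hr => h r hr.1 hr.2⟩

lemma nonCrossing_ncClosure (w : Perm (Fin n)) : NonCrossing (ncClosure w) := by
  intro x z a b hxz hab h1 h2
  rw [ncClosure_iff] at *
  exact fun r hr hw => hr x z a b (hxz r hr hw) (hab r hr hw) h1 h2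

lemma isNCJoin_nextPerm_ncClosure (w : Perm (Fin n)) :
    IsNCJoin (transpositions n) (finRotate n)
      {t | t ∈ transpositions n ∧ AbsLE (transpositions n) t w} (nextPerm (ncClosure w)) := by
  have hNC := isNC_nextPerm (nonCrossing_ncClosure w)
  refine ⟨⟨absLE_one _, absLE_of_arcsStable hNC isNC_finRotate ?_⟩, ?_, ?_⟩
  · intro x y h
    rw [cdist_finRotate] at h
    have := cdist_pos x y
    omega
  · rintro t ⟨⟨x, y, hne, rfl⟩, ht⟩
    rw [absLE_swap_iff hne] at ht ⊢
    rw [nextPerm_sameCycle_iff, ncClosure_iff]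
    exact fun r _ hw => rel_of_sameCycle r hw ht
  · rintro u ⟨-, hu⟩ hle
    have huNC := isNC_of_absLE isNC_finRotate hu
    refine absLE_of_arcsStable hNC huNC fun x y hy => ?_
    refine ArcsStable.sameCycle huNC ?_ hy
    refine ncClosure_iff.mp (next_rel (ncClosure w) y) _ huNC.nonCrossing fun z => ?_
    change u.SameCycle z (w z)
    by_cases hz : z = w z
    · rw [← hz]
    · rw [← absLE_swap_iff hz]
      exact hle _ ⟨⟨z, w z, hz, rfl⟩, (absLE_swap_iff hz).mpr (sameCycle_apply w z)⟩

lemma IsNCJoin.unique {X : Set (Perm (Fin n))} {c u v : Perm (Fin n)}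
    (hu : IsNCJoin (transpositions n) c X u) (hv : IsNCJoin (transpositions n) c X v) : u = v :=
  absLE_antisymm (hu.2.2 v hv.1 hv.2.1) (hv.2.2 u hu.1 hu.2.1)

lemma ncProjA_eq (w : Perm (Fin n)) : ncProjA w = nextPerm (ncClosure w) := by
  have h : ∃ v, IsNCJoin (transpositions n) (finRotate n)
      {t | t ∈ transpositions n ∧ AbsLE (transpositions n) t w} v :=
    ⟨_, isNCJoin_nextPerm_ncClosure w⟩
  unfold ncProjA ncProj
  rw [dif_pos h]
  exact IsNCJoin.unique h.choose_spec (isNCJoin_nextPerm_ncClosure w)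

lemma isNC_ncProjA (w : Perm (Fin n)) : IsNC (ncProjA w) :=
  ncProjA_eq w ▸ isNC_nextPerm (nonCrossing_ncClosure w)

lemma sameCycle_ncProjA (w : Perm (Fin n)) (x : Fin n) : (ncProjA w).SameCycle x (w x) := by
  rw [ncProjA_eq, nextPerm_sameCycle_iff, ncClosure_iff]
  exact fun r _ hw => hw x

lemma rel_ncProjA {w : Perm (Fin n)} {r : Setoid (Fin n)} (hr : NonCrossing r)
    (hw : ∀ x, r x (w x)) (x : Fin n) : r x (ncProjA w x) := by
  rw [ncProjA_eq]
  exact ncClosure_iff.mp (next_rel (ncClosure w) x) r hr hw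

/-- The setoid whose classes are `A` and the singletons outside of `A`. -/
def blockSetoid (A : Set (Fin n)) : Setoid (Fin n) where
  r x y := x = y ∨ (x ∈ A ∧ y ∈ A)
  iseqv := ⟨fun _ => Or.inl rfl, by grind, by grind⟩

lemma blockSetoid_iff {A : Set (Fin n)} {x y : Fin n} :
    blockSetoid A x y ↔ x = y ∨ (x ∈ A ∧ y ∈ A) := Iff.rfl

lemma nonCrossing_blockSetoid (A : Set (Fin n)) : NonCrossing (blockSetoid A) := by
  intro x z a b hxz hab h1 h2
  rw [blockSetoid_iff] at *
  rcases hab with rfl | hab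
  · omega
  rcases hxz with rfl | hxz
  · have := cdist_inj (le_antisymm h2 (by simpa using cdist_le x b))
    subst this
    exact Or.inr ⟨hab.2, hab.1⟩
  · exact Or.inr ⟨hxz.1, hab.1⟩

lemma ncProjA_apply_eq_iff {w : Perm (Fin n)} {x : Fin n} : ncProjA w x = x ↔ w x = x := by
  constructor
  · intro h
    have := sameCycle_ncProjA w x
    obtain ⟨k, hk⟩ := this
    rw [← hk]
    exact zpow_apply_eq_self_of_apply_eq_self h k
  · intro h
    -- The partition into `{x}` and its complement is noncrossing and coarser than the cycles of
    -- `w`, so it bounds the closure.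
    have hrel : ∀ z, blockSetoid {y | y ≠ x} z (w z) := fun z => by
      by_cases hz : z = x
      · subst hz; exact Or.inl h.symm
      · exact Or.inr ⟨hz, fun h' => hz (w.injective (h'.trans h.symm))⟩
    rcases rel_ncProjA (nonCrossing_blockSetoid _) hrel x with h' | h'
    · exact h'.symm
    · exact absurd rfl h'.1

lemma inv_popTA (w : Perm (Fin n)) : (popTA w)⁻¹ = ncProjA w * w⁻¹ := by
  change (w * (ncProjA w)⁻¹)⁻¹ = _
  rw [mul_inv_rev, inv_inv]

/-! ### Winding numbers and antiexceedances -/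

/-- The number of points that are mapped to a smaller point. -/
def desc (u : Perm (Fin n)) : ℕ := (Finset.univ.filter fun y => u y < y).card

lemma sum_cdist_inv (w : Perm (Fin n)) :
    ∑ x, (cdist x (w⁻¹ x) : ℤ) = n * (n - aexc w) := by
  have h1 : ∀ x, (cdist x (w⁻¹ x) : ℤ) =
      ((w⁻¹ x).val : ℤ) - (x.val : ℤ) + n * (1 - if x < w⁻¹ x then 1 else 0) := by
    intro x
    have := cdist_spec x (w⁻¹ x)
    by_cases h : x < w⁻¹ x
    · rw [if_pos h]
      rw [Fin.lt_def] at h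
      simp only [sub_self, mul_zero]
      omega
    · rw [if_neg h]
      rw [Fin.lt_def] at h
      simp only [sub_zero, mul_one]
      omega
  rw [Finset.sum_congr rfl fun x _ => h1 x, Finset.sum_add_distrib, Finset.sum_sub_distrib,
    Equiv.sum_comp w⁻¹ (fun x : Fin n => (x.val : ℤ)), ← Finset.mul_sum, Finset.sum_sub_distrib,
    Finset.sum_boole]
  simp [aexc]

lemma sum_cdist_support (u : Perm (Fin n)) :
    ∑ y, (if u y = y then 0 else cdist y (u y) : ℤ) = n * desc u := by
  have h1 : ∀ y, (if u y = y then 0 else cdist y (u y) : ℤ) =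
      ((u y).val : ℤ) - (y.val : ℤ) + n * (if u y < y then 1 else 0) := by
    intro y
    have := cdist_spec y (u y)
    simp only [Fin.ext_iff, Fin.lt_def]
    split_ifs <;> simp only [mul_zero, mul_one] <;> omega
  rw [Finset.sum_congr rfl fun x _ => h1 x, Finset.sum_add_distrib, Finset.sum_sub_distrib,
    Equiv.sum_comp u (fun x : Fin n => (x.val : ℤ)), ← Finset.mul_sum, Finset.sum_boole]
  simp [desc]

/-- If `w⁻¹ x` is moved, it shares its block with `x`, so moving on to the next point of the block
cannot pass `x`, and the two distances add without wrapping. -/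
lemma cdist_ncProjA_mul (w : Perm (Fin n)) (x : Fin n) :
    cdist x ((ncProjA w) (w⁻¹ x)) = cdist x (w⁻¹ x) +
      if ncProjA w (w⁻¹ x) = w⁻¹ x then 0 else cdist (w⁻¹ x) (ncProjA w (w⁻¹ x)) := by
  split_ifs with h
  · rw [h, add_zero]
  · have h1 : w (w⁻¹ x) ≠ w⁻¹ x := fun h' => h (ncProjA_apply_eq_iff.mpr h')
    have h2 := sameCycle_ncProjA w (w⁻¹ x)
    have h3 : w (w⁻¹ x) = x := w.apply_symm_apply x
    rw [h3] at h1 h2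
    have := (isNC_ncProjA w).cdist_apply_le h2
    have := cdist_add x (w⁻¹ x) (ncProjA w (w⁻¹ x))
    have := cdist_add x (w⁻¹ x) x
    have := cdist_lt_of_ne h1
    have := cdist_pos x (ncProjA w (w⁻¹ x))
    rw [cdist_self] at *
    omega

lemma aexc_popTA_add_desc (hn : 0 < n) (w : Perm (Fin n)) :
    aexc (popTA w) + desc (ncProjA w) = aexc w := by
  have h1 := sum_cdist_inv (popTA w)
  have h2 := sum_cdist_inv w
  have h3 := sum_cdist_support (ncProjA w)
  rw [← Equiv.sum_comp w⁻¹] at h3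
  have h4 : ∑ x, (cdist x ((popTA w)⁻¹ x) : ℤ) = ∑ x, (cdist x (w⁻¹ x) : ℤ) +
      ∑ x, (if ncProjA w (w⁻¹ x) = w⁻¹ x then 0
        else cdist (w⁻¹ x) (ncProjA w (w⁻¹ x)) : ℤ) := by
    rw [← Finset.sum_add_distrib]
    refine Finset.sum_congr rfl fun x _ => ?_
    rw [inv_popTA, Perm.mul_apply, cdist_ncProjA_mul]
    push_cast
    rfl
  rw [h1, h2, h3, ← mul_add] at h4
  have := mul_left_cancel₀ (by exact_mod_cast hn.ne') h4
  omega

lemma cdist_finRotate_mul (s : Perm (Fin n)) (x : Fin n) :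
    cdist x (finRotate n (s x)) = (if s x = x then 0 else cdist x (s x)) + 1 := by
  have h1 := cdist_finRotate (s x)
  split_ifs with h
  · rw [h, cdist_finRotate]
  · have := cdist_add x (s x) (finRotate n (s x))
    have := cdist_lt_of_ne (Ne.symm h)
    have := cdist_pos x (finRotate n (s x))
    omega

lemma aexc_add_desc (hn : 0 < n) {w s : Perm (Fin n)} (h : w⁻¹ = finRotate n * s) :
    aexc w + desc s + 1 = n := by
  have h1 := sum_cdist_inv w
  have h2 := sum_cdist_support s
  have h3 : ∑ x, (cdist x (w⁻¹ x) : ℤ) =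
      ∑ y, (if s y = y then 0 else cdist y (s y) : ℤ) + ∑ _x : Fin n, (1 : ℤ) := by
    rw [← Finset.sum_add_distrib]
    refine Finset.sum_congr rfl fun x _ => ?_
    rw [h, Perm.mul_apply, cdist_finRotate_mul]
    push_cast
    rfl
  rw [h1, h2, Finset.sum_const, Finset.card_univ, Fintype.card_fin, nsmul_eq_mul, ← mul_add] at h3
  have := mul_left_cancel₀ (by exact_mod_cast hn.ne') h3
  omega

lemma eq_one_of_desc_eq_zero {u : Perm (Fin n)} (h : desc u = 0) : u = 1 := by
  have h1 := sum_cdist_support u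
  rw [h, Nat.cast_zero, mul_zero, Finset.sum_eq_zero_iff_of_nonneg] at h1
  · refine Equiv.ext fun y => ?_
    change u y = y
    have := h1 y (Finset.mem_univ y)
    by_contra hne
    rw [if_neg hne] at this
    have := cdist_pos y (u y)
    omega
  · intro y _
    split_ifs <;> omega

lemma ncProjA_eq_one_iff {w : Perm (Fin n)} : ncProjA w = 1 ↔ w = 1 := by
  simp only [Equiv.ext_iff, Perm.one_apply, ncProjA_apply_eq_iff]

lemma desc_ncProjA_pos {w : Perm (Fin n)} (h : w ≠ 1) : 0 < desc (ncProjA w) := by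
  by_contra! h0
  exact h (ncProjA_eq_one_iff.mp (eq_one_of_desc_eq_zero (by omega)))

lemma popTA_one : popTA (1 : Perm (Fin n)) = 1 := by
  change 1 * (ncProjA 1)⁻¹ = 1
  rw [ncProjA_eq_one_iff.mpr rfl, inv_one, one_mul]

/-! ### Orbit lengths -/

lemma forwardOrbit_eq_insert {X : Type*} (f : X → X) (x : X) :
    forwardOrbit f x = insert x (forwardOrbit f (f x)) := by
  ext y
  simp only [forwardOrbit, Set.mem_range, Set.mem_insert_iff]
  constructor
  · rintro ⟨k | k, rfl⟩
    · exact Or.inl rfl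
    · exact Or.inr ⟨k, rfl⟩
  · rintro (rfl | ⟨k, rfl⟩)
    · exact ⟨0, rfl⟩
    · exact ⟨k + 1, rfl⟩

lemma ncard_forwardOrbit_one : (forwardOrbit popTA (1 : Perm (Fin n))).ncard = 1 := by
  have : forwardOrbit popTA (1 : Perm (Fin n)) = {1} := by
    ext y
    simp only [forwardOrbit, Set.mem_range, Set.mem_singleton_iff,
      Function.iterate_fixed popTA_one]
    simp [eq_comm]
  rw [this, Set.ncard_singleton]

lemma aexc_iterate_le (hn : 0 < n) (w : Perm (Fin n)) (k : ℕ) : aexc (popTA^[k] w) ≤ aexc w := by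
  induction k generalizing w with
  | zero => rfl
  | succ k ih =>
    have := aexc_popTA_add_desc hn w
    exact (ih (popTA w)).trans (by omega)

/-- `aexc` drops strictly at the first step and never rises afterwards, so `w` does not recur. -/
lemma ncard_forwardOrbit (hn : 0 < n) {w : Perm (Fin n)} (h : w ≠ 1) :
    (forwardOrbit popTA w).ncard = (forwardOrbit popTA (popTA w)).ncard + 1 := by
  rw [forwardOrbit_eq_insert, Set.ncard_insert_of_notMem]
  rintro ⟨k, hk⟩
  have h1 := aexc_iterate_le hn (popTA w) k
  have h2 := aexc_popTA_add_desc hn w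
  have h3 := desc_ncProjA_pos h
  dsimp only at hk
  rw [hk] at h1
  omega

lemma ncard_forwardOrbit_le (hn : 0 < n) (w : Perm (Fin n)) :
    (forwardOrbit popTA w).ncard ≤ aexc w + 1 := by
  induction hk : aexc w using Nat.strong_induction_on generalizing w with
  | _ k ih =>
    by_cases h : w = 1
    · subst h; rw [ncard_forwardOrbit_one]; omega
    have h2 := aexc_popTA_add_desc hn w
    have h3 := desc_ncProjA_pos h
    have := ih _ (by omega) (popTA w) rfl
    rw [ncard_forwardOrbit hn h]
    omega

lemma ncard_forwardOrbit_eq (hn : 0 < n) (P : Perm (Fin n) → Prop)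
    (hP : ∀ w, P w → w ≠ 1 → desc (ncProjA w) = 1 ∧ P (popTA w)) {w : Perm (Fin n)} (hw : P w) :
    (forwardOrbit popTA w).ncard = aexc w + 1 := by
  induction hk : aexc w using Nat.strong_induction_on generalizing w with
  | _ k ih =>
    by_cases h : w = 1
    · subst h
      have : aexc (1 : Perm (Fin n)) = 0 := by simp [aexc]
      rw [ncard_forwardOrbit_one]; omega
    obtain ⟨h1, h2⟩ := hP w hw h
    have h3 := aexc_popTA_add_desc hn w
    have := ih _ (by omega) h2 rfl
    rw [ncard_forwardOrbit hn h]
    omega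

/-! ### The invariant that keeps a single block -/

/-- The arcs `(p, q]` and `(q, p]` are complementary. -/
lemma cdist_le_iff_lt {p q : Fin n} (hpq : p ≠ q) (z : Fin n) :
    cdist p z ≤ cdist p q ↔ cdist q p < cdist q z := by
  have := cdist_add p q z
  have := cdist_add p q p
  have := cdist_lt_of_ne hpq
  have := cdist_pos q z
  have := cdist_pos p z
  have := cdist_le p z
  rw [cdist_self] at *
  omega

/-- The inversions of the lift of `g` to the universal cover of the circle all start at a point of
a fixed set `S` and end before the next point of `S`; moreover, `S` does not consist of two points
that are moved by `g`. -/
def Good (g : Perm (Fin n)) : Prop :=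
  ∃ S : Set (Fin n),
    (∀ x y, cdist x y + cdist y (g y) ≤ cdist x (g x) → x ∈ S ∧ ∀ t ∈ S, cdist x y < cdist x t) ∧
    ∀ b ∈ S, ∀ d ∈ S, b ≠ d → g b ≠ b → g d ≠ d → ∃ t ∈ S, t ≠ b ∧ t ≠ d

/-- At the boundary of two complementary stable arcs there is an inversion. -/
lemma exists_boundary_inversion {g : Perm (Fin n)} {p q : Fin n} (hpq : p ≠ q)
    (hI : ∀ z, cdist p z ≤ cdist p q → cdist p (g z) ≤ cdist p q)
    (hJ : ∀ z, cdist q z ≤ cdist q p → cdist q (g z) ≤ cdist q p)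
    (hi : ∃ z, cdist p z ≤ cdist p q ∧ g z ≠ z) (hj : ∃ z, cdist q z ≤ cdist q p ∧ g z ≠ z) :
    ∃ b y, (cdist p b ≤ cdist p q ∧ g b ≠ b) ∧ (cdist q y ≤ cdist q p ∧ g y ≠ y) ∧
      cdist p (g b) < cdist p b ∧ cdist q y < cdist q (g y) ∧
      cdist b y + cdist y (g y) ≤ cdist b (g b) := by
  classical
  obtain ⟨i, hi⟩ := hi
  obtain ⟨j, hj⟩ := hj
  -- `b` is the last moved point of its arc, so its image lies behind it and its lift travels around
  -- the whole other arc; `y` is the first moved point there, so it moves forward within that arc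
  -- and is overtaken.
  obtain ⟨b, hb, hbmax⟩ := Finset.exists_max_image
    (Finset.univ.filter fun z => cdist p z ≤ cdist p q ∧ g z ≠ z) (fun z => cdist p z)
    ⟨i, by simpa using hi⟩
  obtain ⟨y, hy, hymin⟩ := Finset.exists_min_image
    (Finset.univ.filter fun z => cdist q z ≤ cdist q p ∧ g z ≠ z) (fun z => cdist q z)
    ⟨j, by simpa using hj⟩
  simp only [Finset.mem_filter, Finset.mem_univ, true_and] at hb hbmax hy hymin
  have hgb : cdist p (g b) < cdist p b :=
    lt_of_le_of_ne (hbmax _ ⟨hI b hb.1, fun h => hb.2 (g.injective h)⟩)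
      (fun h => hb.2 (cdist_inj h))
  have hgy : cdist q y < cdist q (g y) :=
    lt_of_le_of_ne (hymin _ ⟨hJ y hy.1, fun h => hy.2 (g.injective h)⟩)
      (fun h => hy.2 (cdist_inj h).symm)
  refine ⟨b, y, hb, hy, hgb, hgy, ?_⟩
  have hy' := mt (cdist_le_iff_lt hpq y).mp (by omega)
  have := hJ y hy.1
  have h1 := cdist_add p b y
  have h2 := cdist_add p q y
  have h3 := cdist_add p q (g y)
  have h4 := cdist_add p q p
  have h5 := cdist_add q y (g y)
  have h6 := cdist_add p b (g b)
  have := cdist_lt_of_ne hpq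
  have := cdist_pos p (g b)
  have := cdist_le p (g y)
  have := cdist_le p y
  have := cdist_pos q y
  have := cdist_pos q (g y)
  have := cdist_pos y (g y)
  rw [cdist_self] at h4
  omega

/-- The point `t` precedes `b'` on the arc `(q, p]`. As `(b, t)` is not an inversion, the lift of
`t` must go once around. It then overtakes `y'`, so `(t, y')` is an inversion that runs past `b' ∈
S`. -/
lemma third_point_contradiction {g : Perm (Fin n)} {S : Set (Fin n)}
    (hS : ∀ x y, cdist x y + cdist y (g y) ≤ cdist x (g x) →
      x ∈ S ∧ ∀ t ∈ S, cdist x y < cdist x t)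
    {p q b b' y' t : Fin n} (hpq : p ≠ q)
    (hJ : ∀ z, cdist q z ≤ cdist q p → cdist q (g z) ≤ cdist q p)
    (hb : cdist p b ≤ cdist p q) (hgbI : cdist p (g b) ≤ cdist p q)
    (hgb : cdist p (g b) < cdist p b)
    (hb' : cdist q b' ≤ cdist q p) (hb'S : b' ∈ S)
    (hy' : cdist p y' ≤ cdist p q) (hgyI : cdist p (g y') ≤ cdist p q)
    (hgy' : cdist p y' < cdist p (g y'))
    (hinv : cdist b' y' + cdist y' (g y') ≤ cdist b' (g b'))
    (ht : t ∈ S) (htb' : t ≠ b') (htJ : cdist q t ≤ cdist q p) : False := by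
  have hbt : ¬ cdist b t + cdist t (g t) ≤ cdist b (g b) := fun h =>
    lt_irrefl _ ((hS b t h).2 t ht)
  have hb't := (hS b' y' hinv).2 t ht
  have hgt := hJ t htJ
  have iff := cdist_le_iff_lt hpq
  have hbq := (iff b).mp hb
  have hyq := (iff y').mp hy'
  have hgbq := (iff (g b)).mp hgbI
  have hgyq := (iff (g y')).mp hgyI
  have ne : cdist q t ≠ cdist q b' := fun h => htb' (cdist_inj h)
  have hty : ¬ cdist t y' + cdist y' (g y') ≤ cdist t (g t) := fun h => by
    have h1 := (hS t y' h).2 b' hb'S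
    have := cdist_add q t y'
    have := cdist_add q t b'
    have := cdist_add q b' t
    have := cdist_add q b' y'
    omega
  have e1 := cdist_add q p b
  have e2 := cdist_add q p (g b)
  have e3 := cdist_add q p y'
  have e4 := cdist_add q p (g y')
  have e5 := cdist_add q b (g b)
  have e6 := cdist_add q b t
  have e7 := cdist_add q t (g t)
  have e8 := cdist_add q t y'
  have e9 := cdist_add q y' (g y')
  have := cdist_le q (g y')
  have := cdist_pos q (g t)
  have := cdist_pos b (g b)
  have := cdist_pos y' (g y')
  omega

/-- The two boundaries give inversions starting at `b` and `b'` in `S`. A third point of `S` lies on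
one of the two arcs, and the situation is symmetric. -/
lemma Good.not_stable_arc {g : Perm (Fin n)} (hg : Good g) {p q : Fin n} (hpq : p ≠ q)
    (hI : ∀ z, cdist p z ≤ cdist p q → cdist p (g z) ≤ cdist p q)
    (hi : ∃ z, cdist p z ≤ cdist p q ∧ g z ≠ z) (hj : ∃ z, cdist q z ≤ cdist q p ∧ g z ≠ z) :
    False := by
  obtain ⟨S, hS, hthird⟩ := hg
  have iff := cdist_le_iff_lt hpq
  have iff' := cdist_le_iff_lt hpq.symm
  have hJ : ∀ z, cdist q z ≤ cdist q p → cdist q (g z) ≤ cdist q p := by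
    intro z hz
    by_contra! hcon
    have h1 : cdist p z ≤ cdist p q :=
      mem_of_sameCycle (A := {z | cdist p z ≤ cdist p q}) hI (sameCycle_apply g z).symm
        ((iff (g z)).mpr hcon)
    have := (iff z).mp h1
    omega
  obtain ⟨b, y, hb, hy, hgb, hgy, hinv⟩ := exists_boundary_inversion hpq hI hJ hi hj
  obtain ⟨b', y', hb', hy', hgb', hgy', hinv'⟩ :=
    exists_boundary_inversion hpq.symm hJ hI hj hi
  have hbS := (hS _ _ hinv).1
  have hb'S := (hS _ _ hinv').1
  have hne : b ≠ b' := by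
    rintro rfl
    have := (iff b).mp hb.1
    omega
  obtain ⟨t, ht, htb, htb'⟩ := hthird b hbS b' hb'S hne hb.2 hb'.2
  by_cases htJ : cdist q t ≤ cdist q p
  · exact third_point_contradiction hS hpq hJ hb.1 (hI b hb.1) hgb hb'.1 hb'S hy'.1
      (hI y' hy'.1) hgy' hinv' ht htb' htJ
  · exact third_point_contradiction hS hpq.symm hI hb'.1 (hJ b' hb'.1) hgb' hb.1 hbS hy.1
      (hJ y hy.1) hgy hinv ht htb ((iff t).mpr (not_le.mp htJ))

/-- If `w⁻¹` is good, then `π_T(w)` cycles all points moved by `w`. -/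
lemma Good.cdist_ncProjA_le {w : Perm (Fin n)} (hg : Good w⁻¹) {x z : Fin n} (hx : w x ≠ x)
    (hz : w z ≠ z) : cdist x (ncProjA w x) ≤ cdist x z := by
  by_contra! hlt
  have hinv : ∀ a, w a ≠ a → w⁻¹ a ≠ a := fun a ha h => ha (by
    have h' : w (w⁻¹ a) = a := w.apply_symm_apply a
    rwa [h] at h')
  -- With `q` the predecessor of `ncProjA w x`, the half-open arc `(x, q]` is the open arc from `x`
  -- to its image, stable under `w⁻¹`. It contains `z`, and its complement contains `x`.
  set q := (finRotate n)⁻¹ (ncProjA w x) with hq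
  have hq' : finRotate n q = ncProjA w x := (finRotate n).apply_symm_apply _
  have h1 := cdist_finRotate q
  rw [hq'] at h1
  have h2 := cdist_add x q (ncProjA w x)
  have h3 := cdist_le x q
  have h4 := cdist_pos x z
  have h5 : cdist x q + 1 = cdist x (ncProjA w x) := by omega
  have h6 := cdist_le x (ncProjA w x)
  have hpq : x ≠ q := by
    intro h
    rw [← h, cdist_self] at h5
    omega
  refine hg.not_stable_arc hpq (fun a ha => ?_) ⟨z, by omega, hinv z hz⟩ ⟨x, le_rfl, hinv x hx⟩
  have h7 := sameCycle_ncProjA w (w⁻¹ a)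
  have h8 : w (w⁻¹ a) = a := w.apply_symm_apply a
  rw [h8] at h7
  have := ArcsStable.sameCycle (isNC_ncProjA w) (x := x) h7.symm (by omega)
  omega

lemma desc_eq_one {u : Perm (Fin n)} (hu : u ≠ 1)
    (h : ∀ x z, u x ≠ x → u z ≠ z → cdist x (u x) ≤ cdist x z) : desc u = 1 := by
  have h0 : desc u ≠ 0 := fun h0 => hu (eq_one_of_desc_eq_zero h0)
  have h1 : desc u ≤ 1 := by
    refine Finset.card_le_one.mpr fun y hy y' hy' => ?_
    simp only [Finset.mem_filter, Finset.mem_univ, true_and] at hy hy'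
    have e1 := h y y' hy.ne hy'.ne
    have e2 := h y' y hy'.ne hy.ne
    have := cdist_spec y (u y)
    have := cdist_spec y' (u y')
    have := cdist_spec y y'
    have := cdist_spec y' y
    have := y.isLt
    have := y'.isLt
    rw [Fin.lt_def] at hy hy'
    exact Fin.ext (by omega)
  omega

lemma Good.desc_ncProjA {w : Perm (Fin n)} (hg : Good w⁻¹) (hw : w ≠ 1) :
    desc (ncProjA w) = 1 :=
  desc_eq_one (fun h => hw (ncProjA_eq_one_iff.mp h)) fun _ _ hx hz =>
    hg.cdist_ncProjA_le (fun h => hx (ncProjA_apply_eq_iff.mpr h))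
      fun h => hz (ncProjA_apply_eq_iff.mpr h)

/-- On the lift, `π_T(w)` advances each moved point to the next moved one, hence preserves their
order. So Pop creates no inversions and moves no new points, and the same `S` works. -/
lemma Good.pop {w : Perm (Fin n)} (hg : Good w⁻¹) : Good (popTA w)⁻¹ := by
  have hle := fun x z => hg.cdist_ncProjA_le (x := x) (z := z)
  obtain ⟨S, hS, hthird⟩ := hg
  have hfix : ∀ x, w⁻¹ x = x ↔ w x = x := fun x => by
    rw [Perm.inv_eq_iff_eq, eq_comm]
  have hfixπ : ∀ x, w⁻¹ x = x → ncProjA w x = x := fun x h =>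
    ncProjA_apply_eq_iff.mpr ((hfix x).mp h)
  refine ⟨S, fun x y hxy => hS x y ?_, fun b hb b' hb' hne h1 h2 => hthird b hb b' hb' hne ?_ ?_⟩
  · rw [inv_popTA, Perm.mul_apply, Perm.mul_apply] at hxy
    have ex := cdist_ncProjA_mul w x
    have ey := cdist_ncProjA_mul w y
    have hx' := cdist_le x (ncProjA w (w⁻¹ x))
    have hxy' := cdist_pos x y
    by_cases hx : w⁻¹ x = x
    · rw [hx, hfixπ x hx] at ex hxy
      rw [hx]
      omega
    by_cases hy : w⁻¹ y = y
    · rw [hy, hfixπ y hy] at hxy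
      rw [cdist_self] at hxy
      omega
    have hgx : w (w⁻¹ x) ≠ w⁻¹ x := by
      rw [show w (w⁻¹ x) = x from w.apply_symm_apply x]; exact fun h => hx h.symm
    have hgy : w (w⁻¹ y) ≠ w⁻¹ y := by
      rw [show w (w⁻¹ y) = y from w.apply_symm_apply y]; exact fun h => hy h.symm
    rw [if_neg (mt ncProjA_apply_eq_iff.mp hgx)] at ex
    rw [if_neg (mt ncProjA_apply_eq_iff.mp hgy)] at ey
    have l1 := hle _ _ hgx hgy
    have l2 := hle _ _ hgx (fun h => hx ((hfix x).mpr h))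
    have l3 := cdist_add x y (w⁻¹ y)
    have l4 := cdist_add x (w⁻¹ x) (w⁻¹ y)
    have l5 := cdist_pos (w⁻¹ y) (ncProjA w (w⁻¹ y))
    have l6 := cdist_pos x (w⁻¹ y)
    omega
  · intro h
    exact h1 (by rw [inv_popTA, Perm.mul_apply, h, hfixπ b h])
  · intro h
    exact h2 (by rw [inv_popTA, Perm.mul_apply, h, hfixπ b' h])

lemma Good.ncard_forwardOrbit (hn : 0 < n) {w : Perm (Fin n)} (hg : Good w⁻¹) :
    (forwardOrbit popTA w).ncard = aexc w + 1 :=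
  ncard_forwardOrbit_eq hn (fun w => Good w⁻¹) (fun _ h hne => ⟨h.desc_ncProjA hne, h.pop⟩) hg

/-! ### Permutations of the form `c s`: good and bad cases -/

/-- A permutation with a single descent `s y < y` cycles the points that it moves. -/
lemma cdist_le_of_desc_eq_one {s : Perm (Fin n)} (hs : desc s = 1) {x z : Fin n} (hx : s x ≠ x)
    (hz : s z ≠ z) : cdist x (s x) ≤ cdist x z := by
  by_contra! hlt
  have hxz : x ≠ z := by
    rintro rfl
    have := cdist_le x (s x)
    rw [cdist_self] at hlt
    omega
  -- `f i` counts the passage of the arc from `i` to `s i` across the cut just after `z`; the total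
  -- is the winding number `desc s`. If the arc from `x` jumped over `z`, both `x` and `z` would
  -- contribute.
  set f : Fin n → ℤ := fun i => (if s i < i then 1 else 0) + (if i ≤ z then 1 else 0) -
    (if s i ≤ z then 1 else 0) with hf
  have hsum : ∑ i, f i = 1 := by
    rw [hf, Finset.sum_sub_distrib, Finset.sum_add_distrib,
      Equiv.sum_comp s (fun i => if i ≤ z then (1 : ℤ) else 0), add_sub_cancel_right,
      Finset.sum_boole]
    exact_mod_cast hs
  have hnonneg : ∀ i, 0 ≤ f i := by
    intro i
    simp only [hf, Fin.lt_def, Fin.le_def]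
    split_ifs <;> omega
  have hfx : f x = 1 := by
    have := cdist_spec x z
    have := cdist_spec x (s x)
    have := (s x).isLt
    have := z.isLt
    simp only [hf, Fin.lt_def, Fin.le_def]
    split_ifs <;> omega
  have hfz : f z = 1 := by
    have : (s z).val ≠ z.val := fun h => hz (Fin.ext h)
    simp only [hf, Fin.lt_def, Fin.le_def]
    split_ifs <;> omega
  have := Finset.sum_le_sum_of_subset_of_nonneg (f := f) (Finset.subset_univ {x, z})
    fun i _ _ => hnonneg i
  rw [Finset.sum_pair hxz, hfx, hfz, hsum] at this
  omega

/-- Take `S` to be the points moved by `s`. The lift of `c` only adds 1 to every position, so an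
inversion must start at some `x ∈ S` and end before `s x`, the next point of `S`. -/
lemma good_finRotate_mul {s : Perm (Fin n)}
    (h : ∀ x z, s x ≠ x → s z ≠ z → cdist x (s x) ≤ cdist x z)
    (hthird : ∀ b b', s b ≠ b → s b' ≠ b' → b ≠ b' → finRotate n (s b) ≠ b →
      finRotate n (s b') ≠ b' → ∃ t, s t ≠ t ∧ t ≠ b ∧ t ≠ b') :
    Good (finRotate n * s) := by
  refine ⟨{x | s x ≠ x}, fun x y hxy => ?_, fun b hb b' hb' hne h1 h2 => ?_⟩
  · rw [Perm.mul_apply, Perm.mul_apply, cdist_finRotate_mul, cdist_finRotate_mul] at hxy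
    have := cdist_pos x y
    by_cases hx : s x = x
    · rw [if_pos hx] at hxy
      omega
    rw [if_neg hx] at hxy
    have hne : cdist x y ≠ cdist x (s x) := by
      intro he
      have hy := cdist_inj he
      have : s y ≠ y := by rw [hy]; exact fun h' => hx (s.injective h')
      rw [if_neg this] at hxy
      have := cdist_pos y (s y)
      omega
    refine ⟨hx, fun t ht => ?_⟩
    have := h x t hx ht
    omega
  · exact hthird b b' hb hb' hne h1 h2

lemma good_finRotate : Good (finRotate n) := by
  have := good_finRotate_mul (n := n) (s := 1) (by simp) (by simp)
  rwa [mul_one] at this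

/-- The partition into an interval and its complement is noncrossing. -/
lemma nonCrossing_interval (b b' : Fin n) :
    NonCrossing (Setoid.comap (fun z : Fin n => b < z ∧ z ≤ b') ⊥) := by
  intro x z a e hxz hae h1 h2
  change (b < x ∧ x ≤ b') = (b < z ∧ z ≤ b') at hxz
  change (b < a ∧ a ≤ b') = (b < e ∧ e ≤ b') at hae
  change (b < x ∧ x ≤ b') = (b < a ∧ a ≤ b')
  rw [eq_iff_iff] at *
  simp only [Fin.lt_def, Fin.le_def] at *
  have := cdist_spec x a
  have := cdist_spec x z
  have := cdist_spec x e
  have := x.isLt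
  have := a.isLt
  have := z.isLt
  have := e.isLt
  by_contra hcon
  by_cases hx : b.val < x.val ∧ x.val ≤ b'.val
  · have hz := hxz.mp hx
    have ha : ¬ (b.val < a.val ∧ a.val ≤ b'.val) := fun ha => hcon ⟨fun _ => ha, fun _ => hx⟩
    have he := mt hae.mpr ha
    omega
  · have hz := mt hxz.mpr hx
    have ha : (b.val < a.val ∧ a.val ≤ b'.val) := by
      by_contra ha
      exact hcon ⟨fun h => absurd h hx, fun h => absurd h ha⟩
    have he := hae.mp ha
    omega

/-- Here `w` preserves the interval `(b, b']` and its complement, so `π_T(w)` refines this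
noncrossing partition. With no fixed points, the largest element of each part is a descent. -/
lemma two_le_desc_of_swap {w : Perm (Fin n)} {b b' : Fin n} (hlt : b < b')
    (hw : w⁻¹ = finRotate n * swap b b') (hmove : ∀ x, w x ≠ x) : 2 ≤ desc (ncProjA w) := by
  have hg : ∀ x, w (finRotate n (swap b b' x)) = x := fun x => by
    have : w⁻¹ x = finRotate n (swap b b' x) := by rw [hw]; rfl
    rw [← this]
    exact w.apply_symm_apply x
  have hval : ∀ x, ((finRotate n (swap b b' x)).val = 0 ∧ (swap b b' x).val + 1 = n) ∨
      ((finRotate n (swap b b' x)).val = (swap b b' x).val + 1) := fun x => by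
    have := val_finRotate (swap b b' x)
    have := (swap b b' x).isLt
    split_ifs at * <;> omega
  have hstable : ∀ x, (b < x ∧ x ≤ b') ↔
      (b < finRotate n (swap b b' x) ∧ finRotate n (swap b b' x) ≤ b') := by
    intro x
    have h1 := hval x
    have := x.isLt
    have := b'.isLt
    simp only [Fin.lt_def, Fin.le_def] at *
    by_cases hxb : x = b
    · subst hxb
      rw [swap_apply_left] at *
      omega
    by_cases hxb' : x = b'
    · subst hxb'
      rw [swap_apply_right] at *
      omega
    rw [swap_apply_of_ne_of_ne hxb hxb'] at *
    have : x.val ≠ b.val := fun h => hxb (Fin.ext h)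
    have : x.val ≠ b'.val := fun h => hxb' (Fin.ext h)
    omega
  have hrel := rel_ncProjA (w := w) (nonCrossing_interval b b') (fun x => by
    change (b < x ∧ x ≤ b') = (b < w x ∧ w x ≤ b')
    have h1 := hstable (w x)
    have h2 : finRotate n (swap b b' (w x)) = x := w.injective (hg (w x))
    rw [h2] at h1
    exact propext h1.symm)
  have hrel' : ∀ x, (b < x ∧ x ≤ b') ↔ (b < ncProjA w x ∧ ncProjA w x ≤ b') := fun x =>
    eq_iff_iff.mp (hrel x)
  have hne : ∀ x, (ncProjA w x).val ≠ x.val := fun x h =>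
    hmove x (ncProjA_apply_eq_iff.mp (Fin.ext h))
  simp only [Fin.lt_def, Fin.le_def] at hrel' hlt
  -- The largest point of the complement is `n - 1`, unless `b' = n - 1`, when it is `b`.
  have hmem : ∃ m, m ≠ b' ∧ ncProjA w m < m := by
    by_cases hb' : b'.val + 1 = n
    · refine ⟨b, fun h => by rw [h] at hlt; omega, ?_⟩
      have := hrel' b
      have := hne b
      have := (ncProjA w b).isLt
      rw [Fin.lt_def]
      omega
    · have := b'.isLt
      refine ⟨⟨n - 1, by omega⟩, fun h => ?_, ?_⟩
      · have := congrArg Fin.val h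
        simp only at this
        omega
      · have := hne ⟨n - 1, by omega⟩
        have := (ncProjA w ⟨n - 1, by omega⟩).isLt
        rw [Fin.lt_def]
        simp only at *
        omega
  obtain ⟨m, hmb, hm⟩ := hmem
  have hb : ncProjA w b' < b' := by
    have := (hrel' b').mp ⟨hlt, le_rfl⟩
    have := hne b'
    rw [Fin.lt_def]
    omega
  rw [← Finset.card_pair hmb]
  refine Finset.card_le_card fun y hy => ?_
  rcases Finset.mem_insert.mp hy with rfl | hy
  · simpa using hm
  · rw [Finset.mem_singleton.mp hy]
    simpa using hb

/-! ### A-splittable permutations and their splitting sets -/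

lemma cyc_eq_one_iff_isCycle {u : Perm (Fin n)} : cyc u = 1 ↔ u.IsCycle := by
  rw [← card_cycleType_eq_one, cycleType_def, Multiset.card_map]
  rfl

lemma IsNC.cyc_eq_one_iff {u : Perm (Fin n)} (hu : IsNC u) : cyc u = 1 ↔ desc u = 1 := by
  rw [cyc_eq_one_iff_isCycle]
  constructor
  · intro hc
    refine desc_eq_one hc.ne_one fun x z hx hz => ?_
    exact hu.cdist_apply_le (hc.sameCycle hx hz)
  · intro hd
    have hne : u ≠ 1 := by
      rintro rfl
      simp [desc] at hd
    obtain ⟨x, hx⟩ : ∃ x, u x ≠ x := by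
      by_contra! h
      exact hne (Equiv.ext h)
    refine ⟨x, hx, fun y hy => ?_⟩
    by_contra hcon
    obtain ⟨a, ha, hlt⟩ := exists_arc hcon
    have hax : u a ≠ a := fun h => hx ((ha.apply_eq_self_iff).mpr h)
    have := cdist_le_of_desc_eq_one hd hax hy
    omega

lemma aSplittable_iff {w : Perm (Fin n)} :
    ASplittable w ↔ aexc w + 2 = n ∧ desc (ncProjA w) = 1 := by
  unfold ASplittable
  rw [(isNC_ncProjA w).cyc_eq_one_iff]
  refine and_congr_left fun _ => ?_
  omega

/-- The permutation that cycles the points of `S` in the cyclic order. -/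
noncomputable def setCycle (S : Finset (Fin n)) : Perm (Fin n) :=
  nextPerm (blockSetoid (S : Set (Fin n)))

lemma setCycle_ne_iff {S : Finset (Fin n)} (hS : 2 ≤ S.card) {x : Fin n} :
    setCycle S x ≠ x ↔ x ∈ S := by
  constructor
  · intro h
    rcases next_rel (blockSetoid (S : Set (Fin n))) x with h' | h'
    · exact absurd h'.symm h
    · exact h'.1
  · intro hx h
    obtain ⟨y, hy, hyx⟩ := Finset.exists_mem_ne (by omega : 1 < S.card) x
    have h1 : blockSetoid (S : Set (Fin n)) x y := Or.inr ⟨hx, hy⟩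
    have h2 := cdist_next_le h1
    have h3 : next (blockSetoid (S : Set (Fin n))) x = x := h
    have := cdist_lt_of_ne hyx.symm
    rw [h3, cdist_self] at h2
    omega

lemma cdist_setCycle_le {S : Finset (Fin n)} {x z : Fin n} (hx : x ∈ S) (hz : z ∈ S) :
    cdist x (setCycle S x) ≤ cdist x z :=
  cdist_next_le (Or.inr ⟨hx, hz⟩)

/-- The sets `S` for which `c * setCycle S` is the inverse of an `A`-splittable permutation. -/
def splittingSets (n : ℕ) : Finset (Finset (Fin n)) :=
  (Finset.univ.filter fun S => 3 ≤ S.card) ∪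
    Finset.univ.image fun i => {i, finRotate n i}

lemma finRotate_ne (hn : 2 ≤ n) (i : Fin n) : finRotate n i ≠ i := by
  intro h
  have := cdist_finRotate i
  rw [h, cdist_self] at this
  omega

lemma two_le_card_of_mem_splittingSets (hn : 2 ≤ n) {S : Finset (Fin n)}
    (hS : S ∈ splittingSets n) : 2 ≤ S.card := by
  rcases Finset.mem_union.mp hS with h | h
  · have := (Finset.mem_filter.mp h).2
    omega
  · obtain ⟨i, -, rfl⟩ := Finset.mem_image.mp h
    rw [Finset.card_pair (finRotate_ne hn i).symm]

lemma good_setCycle (hn : 2 ≤ n) {S : Finset (Fin n)} (hS : S ∈ splittingSets n) :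
    Good (finRotate n * setCycle S) := by
  have h2 := two_le_card_of_mem_splittingSets hn hS
  refine good_finRotate_mul (fun x z hx hz => ?_) fun b b' hb hb' hne h1 h1' => ?_
  · rw [setCycle_ne_iff h2] at hx hz
    exact cdist_setCycle_le hx hz
  · simp only [setCycle_ne_iff h2] at *
    rcases Finset.mem_union.mp hS with h | h
    · have h3 := (Finset.mem_filter.mp h).2
      have : 0 < (S \ {b, b'}).card := by
        have := Finset.le_card_sdiff {b, b'} S
        have := Finset.card_le_two (a := b) (b := b')
        omega
      obtain ⟨t, ht⟩ := Finset.card_pos.mp this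
      simp only [Finset.mem_sdiff, Finset.mem_insert, Finset.mem_singleton, not_or] at ht
      exact ⟨t, ht⟩
    · obtain ⟨i, -, rfl⟩ := Finset.mem_image.mp h
      -- For an adjacent pair, `c s` fixes `finRotate n i`, so there are no two distinct moved
      -- points in `S`.
      exfalso
      have hfix : setCycle {i, finRotate n i} (finRotate n i) = i := by
        have hm : finRotate n i ∈ ({i, finRotate n i} : Finset (Fin n)) := by simp
        have h4 : setCycle {i, finRotate n i} (finRotate n i) ∈
            ({i, finRotate n i} : Finset (Fin n)) :=
          (setCycle_ne_iff h2).mp fun h' =>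
            (setCycle_ne_iff h2).mpr hm ((setCycle {i, finRotate n i}).injective h')
        rcases Finset.mem_insert.mp h4 with h4 | h4
        · exact h4
        · exact absurd (Finset.mem_singleton.mp h4) ((setCycle_ne_iff h2).mpr hm)
      have hbc : b ≠ finRotate n i := by rintro rfl; exact h1 (by rw [hfix])
      have hbc' : b' ≠ finRotate n i := by rintro rfl; exact h1' (by rw [hfix])
      simp only [Finset.mem_insert, Finset.mem_singleton] at hb hb'
      exact hne ((hb.resolve_right hbc).trans (hb'.resolve_right hbc').symm)

lemma aSplittable_setCycle (hn : 3 ≤ n) {S : Finset (Fin n)} (hS : S ∈ splittingSets n) :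
    ASplittable (finRotate n * setCycle S)⁻¹ := by
  have h2 := two_le_card_of_mem_splittingSets (by omega) hS
  have hg := good_setCycle (by omega) hS
  have hs1 : setCycle S ≠ 1 := by
    intro h
    obtain ⟨x, hx⟩ := Finset.card_pos.mp (by omega : 0 < S.card)
    exact (setCycle_ne_iff h2).mpr hx (by rw [h]; rfl)
  have hd : desc (setCycle S) = 1 := desc_eq_one hs1 fun x z hx hz =>
    cdist_setCycle_le ((setCycle_ne_iff h2).mp hx) ((setCycle_ne_iff h2).mp hz)
  have ha := aexc_add_desc (by omega) (inv_inv (finRotate n * setCycle S))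
  rw [aSplittable_iff]
  refine ⟨by omega, ?_⟩
  refine Good.desc_ncProjA (by rwa [inv_inv]) fun h => ?_
  rw [h] at ha
  have : aexc (1 : Perm (Fin n)) = 0 := by simp [aexc]
  omega

lemma exists_setCycle_of_aSplittable (hn : 3 ≤ n) {w : Perm (Fin n)} (hw : ASplittable w) :
    ∃ S ∈ splittingSets n, (finRotate n * setCycle S)⁻¹ = w := by
  rw [aSplittable_iff] at hw
  set s := (finRotate n)⁻¹ * w⁻¹ with hs
  have hws : w⁻¹ = finRotate n * s := by rw [hs, mul_inv_cancel_left]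
  have hd := aexc_add_desc (by omega) hws
  have hd1 : desc s = 1 := by omega
  have hs1 : s ≠ 1 := by
    intro h
    rw [h] at hd1
    simp [desc] at hd1
  obtain ⟨x, hx⟩ : ∃ x, s x ≠ x := by
    by_contra! h
    exact hs1 (Equiv.ext h)
  have hsx : s (s x) ≠ s x := fun h => hx (s.injective h)
  set S : Finset (Fin n) := Finset.univ.filter fun x => s x ≠ x with hS
  have hmem : ∀ y, y ∈ S ↔ s y ≠ y := fun y => by simp [hS]
  have h2 : 2 ≤ S.card := by
    rw [← Finset.card_pair hx]
    refine Finset.card_le_card fun y hy => ?_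
    rw [hmem]
    rcases Finset.mem_insert.mp hy with rfl | hy
    · exact hsx
    · rw [Finset.mem_singleton.mp hy]; exact hx
  have hsS : setCycle S = s := by
    refine Equiv.ext fun y => ?_
    by_cases hy : y ∈ S
    · have h1 : setCycle S y ∈ S := (setCycle_ne_iff h2).mp fun h =>
        (setCycle_ne_iff h2).mpr hy ((setCycle S).injective h)
      have h3 : s y ∈ S := (hmem _).mpr fun h => (hmem y).mp hy (s.injective h)
      exact cdist_inj (le_antisymm (cdist_setCycle_le hy h3)
        (cdist_le_of_desc_eq_one hd1 ((hmem y).mp hy) ((hmem _).mp h1)))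
    · rw [not_not.mp (mt (setCycle_ne_iff h2).mp hy), not_not.mp (mt (hmem y).mpr hy)]
  refine ⟨S, ?_, by rw [hsS, ← hws, inv_inv]⟩
  by_cases h3 : 3 ≤ S.card
  · exact Finset.mem_union_left _ (Finset.mem_filter.mpr ⟨Finset.mem_univ _, h3⟩)
  obtain ⟨b, b', hlt, hSb⟩ : ∃ b b', b < b' ∧ S = {b, b'} := by
    obtain ⟨b, b', hne, h⟩ := Finset.card_eq_two.mp (by omega : S.card = 2)
    rcases lt_or_gt_of_ne hne with hlt | hlt
    · exact ⟨b, b', hlt, h⟩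
    · exact ⟨b', b, hlt, by rw [h, Finset.pair_comm]⟩
  have hmem' : ∀ y, s y ≠ y ↔ y = b ∨ y = b' := fun y => by rw [← hmem, hSb]; simp
  have hsb : s b = b' := by
    have hb := (hmem' b).mpr (Or.inl rfl)
    exact ((hmem' _).mp fun h => hb (s.injective h)).resolve_left hb
  have hsb' : s b' = b := by
    have hb := (hmem' b').mpr (Or.inr rfl)
    exact ((hmem' _).mp fun h => hb (s.injective h)).resolve_right hb
  have hswap : s = swap b b' := by
    refine Equiv.ext fun y => ?_
    by_cases hyb : y = b
    · rw [hyb, hsb, swap_apply_left]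
    by_cases hyb' : y = b'
    · rw [hyb', hsb', swap_apply_right]
    rw [swap_apply_of_ne_of_ne hyb hyb']
    exact not_not.mp (mt (hmem' y).mp (by tauto))
  rw [splittingSets, Finset.mem_union, Finset.mem_image]
  right
  -- If `{b, b'}` is not adjacent, `c s` has no fixed point, and `two_le_desc_of_swap` contradicts
  -- the single block.
  by_contra hcon
  have hfix : ∀ y, w y ≠ y := by
    intro y hy
    have h4 : finRotate n (s y) = y := by
      have : w⁻¹ y = y := by rw [Perm.inv_eq_iff_eq, hy]
      rw [hws] at this
      exact this
    by_cases hyb : y = b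
    · subst hyb
      rw [hsb] at h4
      exact hcon ⟨b', Finset.mem_univ _, by rw [h4, hSb, Finset.pair_comm]⟩
    by_cases hyb' : y = b'
    · subst hyb'
      rw [hsb'] at h4
      exact hcon ⟨b, Finset.mem_univ _, by rw [h4, hSb]⟩
    have : s y = y := not_not.mp (mt (hmem' y).mp (by tauto))
    rw [this] at h4
    exact finRotate_ne (by omega) y h4
  have := two_le_desc_of_swap hlt (hswap ▸ hws) hfix
  omega

/-- Forward, the bounds `aexc w ≤ n - 2` and `desc (ncProjA w) ≥ 1` leave no slack, so both are
equalities. -/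
lemma ncard_forwardOrbit_eq_iff (hn : 3 ≤ n) (w : Perm (Fin n)) :
    ((forwardOrbit popTA w).ncard : ℤ) = (n : ℤ) - 1 ↔ ASplittable w := by
  constructor
  · intro h
    have hws : w⁻¹ = finRotate n * ((finRotate n)⁻¹ * w⁻¹) := by rw [mul_inv_cancel_left]
    have hd := aexc_add_desc (by omega) hws
    have hle := ncard_forwardOrbit_le (by omega) w
    have hd0 : desc ((finRotate n)⁻¹ * w⁻¹) ≠ 0 := by
      intro h0
      rw [eq_one_of_desc_eq_zero h0, mul_one] at hws
      have := Good.ncard_forwardOrbit (w := w) (by omega) (hws ▸ good_finRotate)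
      omega
    have hw1 : w ≠ 1 := by
      rintro rfl
      rw [ncard_forwardOrbit_one] at h
      omega
    have h1 := ncard_forwardOrbit (by omega) hw1
    have h2 := ncard_forwardOrbit_le (by omega) (popTA w)
    have h3 := aexc_popTA_add_desc (by omega) w
    have h4 := desc_ncProjA_pos hw1
    rw [aSplittable_iff]
    omega
  · intro h
    obtain ⟨S, hS, rfl⟩ := exists_setCycle_of_aSplittable hn h
    have := Good.ncard_forwardOrbit (w := (finRotate n * setCycle S)⁻¹) (by omega)
      (by rw [inv_inv]; exact good_setCycle (by omega) hS)
    rw [aSplittable_iff] at h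
    omega

/-! ### Counting -/

lemma card_filter_three_le :
    (Finset.univ.filter fun S : Finset (Fin n) => 3 ≤ S.card).card + (1 + n + n.choose 2) =
      2 ^ n := by
  have h1 := Finset.card_filter_add_card_filter_not (s := (Finset.univ : Finset (Finset (Fin n))))
    (fun S => 3 ≤ S.card)
  have h2 : (Finset.univ.filter fun S : Finset (Fin n) => ¬ 3 ≤ S.card) =
      (Finset.range 3).biUnion fun k => Finset.powersetCard k Finset.univ := by
    ext S
    simp
  rw [h2, Finset.card_biUnion] at h1
  · simp only [Finset.card_powersetCard, Finset.sum_range_succ, Finset.sum_range_zero,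
      Finset.card_univ, Fintype.card_fin, Fintype.card_finset, Nat.choose_zero_right,
      Nat.choose_one_right] at h1
    omega
  · intro i _ j _ hij
    exact Finset.pairwise_disjoint_powersetCard _ hij

lemma card_splittingSets (hn : 3 ≤ n) :
    (splittingSets n).card + (1 + n.choose 2) = 2 ^ n := by
  have h1 := card_filter_three_le (n := n)
  rw [splittingSets, Finset.card_union_of_disjoint, Finset.card_image_of_injective]
  · rw [Finset.card_univ, Fintype.card_fin]
    omega
  -- Two equal adjacent pairs with different starting points would each succeed the other, which
  -- needs `n = 2`.
  · intro i j hij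
    replace hij : ({i, finRotate n i} : Finset (Fin n)) = {j, finRotate n j} := hij
    by_contra hne
    have hi : i ∈ ({j, finRotate n j} : Finset (Fin n)) := by
      rw [← hij]; simp
    have hj : j ∈ ({i, finRotate n i} : Finset (Fin n)) := by
      rw [hij]; simp
    simp only [Finset.mem_insert, Finset.mem_singleton] at hi hj
    have hi := hi.resolve_left hne
    have hj := hj.resolve_left (Ne.symm hne)
    have e1 := cdist_finRotate i
    have e2 := cdist_finRotate j
    rw [← hj] at e1
    rw [← hi] at e2
    have := cdist_spec i j
    have := cdist_spec j i
    omega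
  · rw [Finset.disjoint_left]
    intro S h3 hS
    have h3 := (Finset.mem_filter.mp h3).2
    obtain ⟨i, -, rfl⟩ := Finset.mem_image.mp hS
    have := Finset.card_le_two (a := i) (b := finRotate n i)
    omega

lemma ncard_aSplittable (hn : 3 ≤ n) :
    {w : Perm (Fin n) | ASplittable w}.ncard = (splittingSets n).card := by
  have himage : {w : Perm (Fin n) | ASplittable w} =
      (fun S => (finRotate n * setCycle S)⁻¹) '' (splittingSets n : Set (Finset (Fin n))) := by
    ext w
    constructor
    · exact exists_setCycle_of_aSplittable hn
    · rintro ⟨S, hS, rfl⟩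
      exact aSplittable_setCycle hn hS
  rw [himage, Set.InjOn.ncard_image, Set.ncard_coe_finset]
  intro S hS S' hS' h
  have h : setCycle S = setCycle S' := mul_left_cancel (inv_injective h)
  ext x
  rw [← setCycle_ne_iff (two_le_card_of_mem_splittingSets (by omega) hS),
    ← setCycle_ne_iff (two_le_card_of_mem_splittingSets (by omega) hS'), h]

end PopTsack

theorem theorem1p3 (n : ℕ) (hn : 3 ≤ n) :
    (∀ w : Equiv.Perm (Fin n),
      ((forwardOrbit popTA w).ncard : ℤ) = (n : ℤ) - 1 ↔ ASplittable w) ∧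
    (({w : Equiv.Perm (Fin n) |
        ((forwardOrbit popTA w).ncard : ℤ) = (n : ℤ) - 1}.ncard : ℕ) : ℤ) =
      2 ^ n - (n.choose 2 : ℤ) - 1 := by
  have h := PopTsack.ncard_forwardOrbit_eq_iff hn
  refine ⟨h, ?_⟩
  simp only [h]
  rw [PopTsack.ncard_aSplittable hn]
  have := PopTsack.card_splittingSets hn
  zify at this
  linarith
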